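/- Let $E$ be a quaternionic locally convex space, i.e. a Hausdorff topological right vector space over the quaternions $\mathbb{H}$ whose origin has a neighbourhood basis of convex sets. Let $E'$ be its strong dual: the left $\mathbb{H}$-vector space of continuous right-linear maps $x':E\to\mathbb{H}$, $\langle x',x\rangle=x'(x)$, with the topology of uniform convergence on bounded sets. Let $E\otimes E'$ be the tensor product over $\mathbb{H}$ (so $(xq)\otimes x'=x\otimes(qx')$), endowed with the strongest locally convex topology for which $(x,x')\mapsto x\otimes x'$ is separately continuous, and let $E\overline{\otimes}E'$ be its completion. Let $T_{\mathbb{H},1}:E\overline{\otimes}E'\to\mathbb{R}$ be the continuous $\mathbb{R}$-linear form with $T_{\mathbb{H},1}(x\otimes x')=2\,\mathrm{Re}\,\langle x',x\rangle$. A Fredholm kernel on $E$ is an element of $E\overline{\otimes}E'$ of the form $$u=\sum_{k=1}^\infty \mu_k\,x_k\otimes x_k',$$ where $(\mu_k)\in\ell^1$ is a real sequence, and $\{x_k\}\subset B$, $\{x_k'\}\subset B'$ for some bounded absolutely convex sets $B\subset E$, $B'\subset E'$ such that the normed spaces $E_B$, $E'_{B'}$ (the linear span of $B$, respectively $B'$,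 normed by $\|x\|_B=\inf\{t>0: x\in tB\}$, respectively by its analogue for $B'$) are complete. For $0<p\le 1$ it is called $p$-summable if such a representation exists with $(\mu_k)\in\ell^p$. For Fredholm kernels $u=\sum_k\mu_kx_k\otimes x_k'$ and $v=\sum_\ell\nu_\ell y_\ell\otimes y_\ell'$ put $$v\circ u=\sum_{k,\ell}\mu_k\nu_\ell\,(y_\ell\langle y_\ell',x_k\rangle)\otimes x_k',$$ and let $u^1=u$, $u^{k}=u\circ u^{k-1}$ for $k\ge 2$. Put $T_{\mathbb{H},0}(u)=1$ and, for $k\ge1$, $$T_{\mathbb{H},k}(u)=\frac1{k!}\begin{vmatrix}T_{\mathbb{H},1}(u)&k-1&0&\cdots&0\\ T_{\mathbb{H},1}(u^2)&T_{\mathbb{H},1}(u)&k-2&\cdots&0\\ \vdots&\vdots&\ddots&\ddots&\vdots\\ T_{\mathbb{H},1}(u^{k-1})&T_{\mathbb{H},1}(u^{k-2})&\cdots&T_{\mathbb{H},1}(u)&1\\ T_{\mathbb{H},1}(u^k)&T_{\mathbb{H},1}(u^{k-1})&\cdots&T_{\mathbb{H},1}(u^2)&T_{\mathbb{H},1}(u)\end{vmatrix}.$$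 **Theorem.** Let $0<p\le1$ and let $u$ be a $p$-summable Fredholm kernel on $E$. Then the quaternionic Fredholm determinant $$\det{}_{\mathbb{H}}(I+zu)=\sum_{k=0}^\infty T_{\mathbb{H},k}(u)\,z^k$$ converges for every $z\in\mathbb{C}$ and is an entire function of $z$ of order at most $\left(\frac1p-\frac12\right)^{-1}$. Here the order of an entire function $f$ is $\limsup_{r\to\infty}\frac{\log\log M(r)}{\log r}$ with $M(r)=\max_{|z|=r}|f(z)|$ (a constant function has order $0$). -/

import Mathlib

open scoped Quaternion TensorProduct RightActions

set_option linter.unusedSectionVars false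

noncomputable section

namespace QuatLCS

/-! ### Quaternionic locally convex spaces and their strong duals

A right `ℍ[ℝ]`-vector space is a module over the opposite ring `ℍ[ℝ]ᵐᵒᵖ`; the right multiplication
of `x` by `q` is `x <• q`. -/

section Dual

variable (E : Type*) [AddCommGroup E] [Module ℝ E] [Module ℍ[ℝ]ᵐᵒᵖ E] [TopologicalSpace E]

/-- The dual `E'`: all continuous right-linear maps `x' : E → ℍ[ℝ]`, i.e. `x' (x <• q) = x' x * q`.
It is a left `ℍ[ℝ]`-vector space by `(q • x') x = q * x' x`. -/
abbrev QDual : Type _ := E →L[ℍ[ℝ]ᵐᵒᵖ] ℍ[ℝ]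

/-- The strong topology of the dual: uniform convergence on the bounded subsets of `E`. -/
instance QDual.instTopologicalSpace : TopologicalSpace (QDual E) :=
  TopologicalSpace.induced
    (fun f : QDual E => UniformOnFun.ofFun {S : Set E | Bornology.IsVonNBounded ℝ S} (fun x => f x))
    inferInstance

end Dual

/-- `IsBanachDisk K B`: the set `B` in the `K`-vector space `V` (`K` is `ℍ[ℝ]ᵐᵒᵖ` for right
spaces and `ℍ[ℝ]` for left ones) is bounded and absolutely convex, and the normed space `V_B`, that
is the `K`-span of `B` with the norm `gauge B x = inf {t > 0 | x ∈ t B}`, is complete (every Cauchy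
sequence of `V_B` converges in `V_B`). -/
structure IsBanachDisk (K : Type*) [NormedRing K] {V : Type*} [AddCommGroup V] [Module ℝ V]
    [Module K V] [TopologicalSpace V] (B : Set V) : Prop where
  convex : Convex ℝ B
  balanced : Balanced K B
  bounded : Bornology.IsVonNBounded ℝ B
  complete : ∀ s : ℕ → V, (∀ n, s n ∈ Submodule.span K B) →
    (∀ ε : ℝ, 0 < ε → ∃ N, ∀ m ≥ N, ∀ n ≥ N, gauge B (s m - s n) < ε) →
    ∃ x ∈ Submodule.span K B, ∀ ε : ℝ, 0 < ε → ∃ N, ∀ n ≥ N, gauge B (s n - x) < ε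

/-! ### The tensor product of a right and a left space, and the inductive tensor product -/

section Tensor

variable (E F : Type*) [AddCommGroup E] [Module ℝ E] [Module ℍ[ℝ]ᵐᵒᵖ E]
  [AddCommGroup F] [Module ℝ F] [Module ℍ[ℝ] F]

/-- The balance relations `(x q) ⊗ y = x ⊗ (q y)`. -/
def balanceRel : Submodule ℝ (E ⊗[ℝ] F) :=
  Submodule.span ℝ {t | ∃ (x : E) (q : ℍ[ℝ]) (y : F), t = (x <• q) ⊗ₜ[ℝ] y - x ⊗ₜ[ℝ] (q • y)}

/-- The tensor product `E ⊗ F` over `ℍ[ℝ]` of a right space `E` and a left space `F`, with its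
real vector space structure. -/
def QTensor : Type _ := (E ⊗[ℝ] F) ⧸ balanceRel E F

instance : AddCommGroup (QTensor E F) :=
  inferInstanceAs (AddCommGroup ((E ⊗[ℝ] F) ⧸ balanceRel E F))

instance : Module ℝ (QTensor E F) :=
  inferInstanceAs (Module ℝ ((E ⊗[ℝ] F) ⧸ balanceRel E F))

variable {E F}

/-- The canonical balanced map `(x, y) ↦ x ⊗ y`. -/
def qtmul (x : E) (y : F) : QTensor E F := (balanceRel E F).mkQ (x ⊗ₜ[ℝ] y)

theorem qtmul_balanced (x : E) (q : ℍ[ℝ]) (y : F) : qtmul (x <• q) y = qtmul x (q • y) :=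
  (Submodule.Quotient.eq (balanceRel E F)).2 (Submodule.subset_span ⟨x, q, y, rfl⟩)

/-- The real-linear map on `E ⊗ F` induced by a balanced real-bilinear map. -/
def QTensor.lift {M : Type*} [AddCommGroup M] [Module ℝ M] (Φ : E →ₗ[ℝ] F →ₗ[ℝ] M)
    (hΦ : ∀ x (q : ℍ[ℝ]) y, Φ (x <• q) y = Φ x (q • y)) : QTensor E F →ₗ[ℝ] M :=
  (balanceRel E F).liftQ (TensorProduct.lift Φ) (by
    unfold balanceRel
    rw [Submodule.span_le]
    rintro _ ⟨x, q, y, rfl⟩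
    simp [hΦ])

@[simp]
theorem QTensor.lift_qtmul {M : Type*} [AddCommGroup M] [Module ℝ M] (Φ : E →ₗ[ℝ] F →ₗ[ℝ] M)
    (hΦ : ∀ x (q : ℍ[ℝ]) y, Φ (x <• q) y = Φ x (q • y)) (x : E) (y : F) :
    QTensor.lift Φ hΦ (qtmul x y) = Φ x y :=
  (Submodule.liftQ_apply _ _ _).trans (TensorProduct.lift.tmul _ _)

variable [TopologicalSpace E] [TopologicalSpace F]

/-- The topologies `t` on `E ⊗ F` which make it a locally convex real topological vector space
and for which `(x, y) ↦ x ⊗ y` is separately continuous. -/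
def IsAdmissible (t : TopologicalSpace (QTensor E F)) : Prop :=
  @IsTopologicalAddGroup (QTensor E F) t _ ∧
  @ContinuousSMul ℝ (QTensor E F) _ _ t ∧
  @LocallyConvexSpace ℝ (QTensor E F) _ _ _ _ t ∧
  (∀ y : F, @Continuous E (QTensor E F) _ t fun x => qtmul x y) ∧
  (∀ x : E, @Continuous F (QTensor E F) _ t fun y => qtmul x y)

/-- The inductive topology on `E ⊗ F`: the strongest admissible topology. In Mathlib's order of
topologies smaller means stronger; that `sInf` is itself admissible is `isAdmissible_inductive`. -/
instance QTensor.instTopologicalSpace : TopologicalSpace (QTensor E F) :=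
  sInf {t | IsAdmissible t}

theorem isAdmissible_inductive :
    IsAdmissible (QTensor.instTopologicalSpace : TopologicalSpace (QTensor E F)) :=
  ⟨topologicalAddGroup_sInf fun _ h => h.1, continuousSMul_sInf fun _ h => h.2.1,
    LocallyConvexSpace.sInf fun _ h => h.2.2.1,
    fun y => continuous_sInf_rng.2 fun _ h => h.2.2.2.1 y,
    fun x => continuous_sInf_rng.2 fun _ h => h.2.2.2.2 x⟩

instance : IsTopologicalAddGroup (QTensor E F) := isAdmissible_inductive.1

instance : ContinuousSMul ℝ (QTensor E F) := isAdmissible_inductive.2.1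

instance : LocallyConvexSpace ℝ (QTensor E F) := isAdmissible_inductive.2.2.1

/-- A separately continuous balanced real-bilinear form induces a continuous form on `E ⊗ F`. -/
theorem QTensor.continuous_lift (Φ : E →ₗ[ℝ] F →ₗ[ℝ] ℝ)
    (hΦ : ∀ x (q : ℍ[ℝ]) y, Φ (x <• q) y = Φ x (q • y))
    (h₁ : ∀ y, Continuous fun x => Φ x y) (h₂ : ∀ x, Continuous fun y => Φ x y) :
    Continuous (QTensor.lift Φ hΦ) := by
  rw [continuous_iff_le_induced]
  refine sInf_le ⟨topologicalAddGroup_induced _, continuousSMul_induced _,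
    LocallyConvexSpace.induced _, fun y => ?_, fun x => ?_⟩
  · rw [continuous_induced_rng]; simpa [Function.comp_def] using h₁ y
  · rw [continuous_induced_rng]; simpa [Function.comp_def] using h₂ x

instance QTensor.instUniformSpace : UniformSpace (QTensor E F) :=
  (IsTopologicalAddGroup.rightUniformSpace (QTensor E F)).replaceTopology rfl

instance : IsUniformAddGroup (QTensor E F) := by
  unfold QTensor.instUniformSpace
  rw [UniformSpace.replaceTopology_eq]
  exact isUniformAddGroup_of_addCommGroup

instance : UniformContinuousConstSMul ℝ (QTensor E F) :=
  uniformContinuousConstSMul_of_continuousConstSMul ℝ (QTensor E F)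

variable (E F) in
/-- The inductive tensor product: the completion of `E ⊗ F` in the inductive topology. -/
abbrev IndTensor : Type _ := UniformSpace.Completion (QTensor E F)

/-- The elementary tensor `x ⊗ y` in the inductive tensor product. -/
def itmul (x : E) (y : F) : IndTensor E F := ((qtmul x y : QTensor E F) : IndTensor E F)

end Tensor

/-! ### The quaternionic trace, Fredholm kernels, and the Fredholm determinant -/

section Kernels

variable {E : Type*} [AddCommGroup E] [Module ℝ E] [Module ℍ[ℝ]ᵐᵒᵖ E]
  [IsScalarTower ℝ ℍ[ℝ]ᵐᵒᵖ E] [TopologicalSpace E]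

/-- The canonical balanced form `(x, x') ↦ 2 Re ⟨x', x⟩` on `E × E'`. -/
def pairing : E →ₗ[ℝ] QDual E →ₗ[ℝ] ℝ :=
  LinearMap.mk₂ ℝ (fun x f => 2 * (f x).re)
    (fun x y f => by simp [mul_add])
    (fun c x f => by
      have h : f (c • x) = c • f x := by
        rw [← one_smul ℍ[ℝ]ᵐᵒᵖ x, ← smul_assoc, map_smul, map_smul, one_smul]
        simp
      simp only [h, Quaternion.re_smul, smul_eq_mul]; ring)
    (fun x f g => by simp [mul_add])
    (fun c x f => by simp; ring)

@[simp]
theorem pairing_apply (x : E) (f : QDual E) : pairing x f = 2 * (f x).re := rfl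

theorem pairing_balanced (x : E) (q : ℍ[ℝ]) (f : QDual E) :
    pairing (x <• q) f = pairing x (q • f) := by
  simp only [pairing_apply, map_smul, smul_apply, smul_eq_mul,
    MulOpposite.smul_eq_mul_unop, MulOpposite.unop_op, Quaternion.re_mul]
  ring

/-- The quaternionic trace on the algebraic tensor product, `x ⊗ x' ↦ 2 Re ⟨x', x⟩`. -/
def traceAlg : QTensor E (QDual E) →ₗ[ℝ] ℝ := QTensor.lift pairing pairing_balanced

theorem QDual.continuous_eval (x : E) [ContinuousSMul ℝ E] :
    Continuous fun f : QDual E => f x := by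
  have h : Continuous fun g : UniformOnFun E ℍ[ℝ] {S : Set E | Bornology.IsVonNBounded ℝ S} =>
      UniformOnFun.toFun _ g x :=
    (UniformOnFun.uniformContinuous_eval_of_mem ℍ[ℝ] {S : Set E | Bornology.IsVonNBounded ℝ S}
      (Set.mem_singleton x) (Bornology.isVonNBounded_singleton x)).continuous
  exact h.comp continuous_induced_dom

theorem continuous_traceAlg [ContinuousSMul ℝ E] :
    Continuous (traceAlg : QTensor E (QDual E) →ₗ[ℝ] ℝ) :=
  QTensor.continuous_lift _ _
    (fun f => continuous_const.mul (Quaternion.continuous_re.comp f.continuous))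
    (fun x => continuous_const.mul (Quaternion.continuous_re.comp (QDual.continuous_eval x)))

/-- The first-order quaternionic trace: the continuous extension of `traceAlg` to the inductive
tensor product. -/
def qTrace : IndTensor E (QDual E) → ℝ :=
  UniformSpace.Completion.extension (traceAlg : QTensor E (QDual E) →ₗ[ℝ] ℝ)

theorem continuous_qTrace : Continuous (qTrace : IndTensor E (QDual E) → ℝ) :=
  UniformSpace.Completion.continuous_extension

theorem qTrace_coe [ContinuousSMul ℝ E] (t : QTensor E (QDual E)) :
    qTrace (t : IndTensor E (QDual E)) = traceAlg t :=
  UniformSpace.Completion.extension_coe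
    (uniformContinuous_addMonoidHom_of_continuous
      (f := (traceAlg : QTensor E (QDual E) →ₗ[ℝ] ℝ).toAddMonoidHom)
      (continuous_traceAlg (E := E))) t

/-- The data `(μ, x, x')` admitted in the representation of a Fredholm kernel: a real sequence
`μ ∈ ℓ¹` and sequences `x` in `E`, `x'` in `E'`, each contained in a Banach disk. -/
structure IsFredholmData (μ : ℕ → ℝ) (x : ℕ → E) (x' : ℕ → QDual E) : Prop where
  summable : Summable fun k => |μ k|
  disk : ∃ B : Set E, IsBanachDisk ℍ[ℝ]ᵐᵒᵖ B ∧ ∀ k, x k ∈ B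
  disk' : ∃ B' : Set (QDual E), IsBanachDisk ℍ[ℝ] B' ∧ ∀ k, x' k ∈ B'

/-- `u = ∑ μ_k x_k ⊗ x'_k` in the inductive tensor product, with `(μ, x, x')` as above. The elements
`u` having such a representation are the Fredholm kernels on `E`. -/
def IsFredholmRep (μ : ℕ → ℝ) (x : ℕ → E) (x' : ℕ → QDual E) (u : IndTensor E (QDual E)) : Prop :=
  IsFredholmData μ x x' ∧ HasSum (fun k => μ k • itmul (x k) (x' k)) u

/-- `p`-summable Fredholm kernels on `E`: some representation has `μ ∈ ℓ^p`. -/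
def IsPSummableFredholmKernel (p : ℝ) (u : IndTensor E (QDual E)) : Prop :=
  ∃ μ x x', IsFredholmRep μ x x' u ∧ Summable fun k => |μ k| ^ p

/-- `w = ∑_{k,l} μ_k ν_l (y_l ⟨y'_l, x_k⟩) ⊗ x'_k`, where `v = ∑ ν_l y_l ⊗ y'_l` and
`u = ∑ μ_k x_k ⊗ x'_k` are representations of the Fredholm kernels `v` and `u`. -/
def IsComposition (v u w : IndTensor E (QDual E)) : Prop :=
  ∃ (ν : ℕ → ℝ) (y : ℕ → E) (y' : ℕ → QDual E) (μ : ℕ → ℝ) (x : ℕ → E) (x' : ℕ → QDual E),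
    IsFredholmRep ν y y' v ∧ IsFredholmRep μ x x' u ∧
    HasSum (fun kl : ℕ × ℕ =>
      (μ kl.1 * ν kl.2) • itmul (y kl.2 <• (y' kl.2 (x kl.1))) (x' kl.1)) w

open Classical in
/-- The composition `v ∘ u` of Fredholm kernels. For Fredholm kernels the series in `IsComposition`
converges and its sum depends only on `v` and `u`, not on their representations: for a continuous
real-linear form `Φ` on the inductive tensor product, both
`(y, y') ↦ Φ ((y ⟨y', x⟩) ⊗ x')` (for fixed `x`, `x'`) and
`(x, x') ↦ ∑ ν_l Φ ((y_l ⟨y'_l, x⟩) ⊗ x')` are balanced and separately continuous. -/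
def comp (v u : IndTensor E (QDual E)) : IndTensor E (QDual E) :=
  if h : ∃ w, IsComposition v u w then h.choose else 0

/-- Powers of a Fredholm kernel: `kernelPow u n = u^(n+1)`, where `u^(n+2) = u ∘ u^(n+1)`. -/
def kernelPow (u : IndTensor E (QDual E)) : ℕ → IndTensor E (QDual E)
  | 0 => u
  | n + 1 => comp u (kernelPow u n)

/-- The `k`-th order trace: `1 / k!` times the determinant of the `k × k` matrix whose
`(i, j)` entry (`0 ≤ i, j < k`) is the trace of `u^(i-j+1)` for `j ≤ i`, is `k-1-i` for `j = i + 1`,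
and is `0` otherwise. For `k = 0` the value is `1`. -/
def higherTrace (u : IndTensor E (QDual E)) (k : ℕ) : ℝ :=
  (1 / (k.factorial : ℝ)) * Matrix.det (Matrix.of fun i j : Fin k =>
    if (j : ℕ) ≤ i then qTrace (kernelPow u (i - j))
    else if (j : ℕ) = i + 1 then (k : ℝ) - 1 - (i : ℝ) else 0)

/-- The quaternionic Fredholm determinant `det (I + z u) = ∑ T_k(u) z^k`. -/
def fredholmDet (u : IndTensor E (QDual E)) (z : ℂ) : ℂ :=
  ∑' k : ℕ, (higherTrace u k : ℂ) * z ^ k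

end Kernels

/-! ### Order of an entire function -/

/-- The maximum modulus `M(r) = max_{|z| = r} |f z|`. -/
def maxModulus (f : ℂ → ℂ) (r : ℝ) : ℝ := sSup ((fun z => ‖f z‖) '' Metric.sphere (0 : ℂ) r)

/-- The order of an entire function: `limsup_{r → ∞} log (log M(r)) / log r`, an extended real. -/
def growthOrder (f : ℂ → ℂ) : EReal :=
  Filter.limsup (fun r : ℝ => ((Real.log (Real.log (maxModulus f r)) / Real.log r : ℝ) : EReal))
    Filter.atTop

end QuatLCS

end

/-! ### Newton's identities, Hadamard's inequality, and coefficients of `det (1 + X M)`. -/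

section MatrixDeterminants

open Matrix Polynomial Finset

/-! Everything follows from a coefficient bound `|T_k(u)| ≤ K ^ k / (k!) ^ α` with `α = 1/p - 1/2`.
Comparison with the exponential series turns it into `|f(z)| ≤ 2 exp (α (2 K |z|) ^ (1/α))`, so `f`
is entire of order at most `1/α`.

For the coefficient bound, take a representation `u = ∑ μ_k x_k ⊗ x'_k`, rescaled so that `‖⟨x'_m,
x_k⟩‖ ≤ 1`. The trace of a power of `u` is then the trace of the same power of the infinite
quaternionic matrix `(⟨x'_m, x_k⟩ μ_k)`, where `2 Re q` is the trace of the complex `2 × 2` matrix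
of `q`. Truncating `μ` to `N` terms gives the power traces of a complex matrix `M` of order `2 N`.
Newton's identities (`Matrix.succ_mul_coeff_det_one_add_X_smul`), solved by a determinant
(`Matrix.det_newton_hessenberg`), identify the truncated `T_k` with the coefficient of `X ^ k` in
`det (1 + X M)`, a sum of principal `k × k` minors. Hadamard's inequality bounds a minor by `k ^
(k/2)` times a product of weights `|μ_i|`, and the `ℓ^p` condition makes the sum of these products
at most `C ^ k k ^ (-k/p)`; the two exponents combine to `α`. The bound does not depend on `N`, so
it survives the limit.

Computing the powers of `u` from one representation requires the composition to be well defined. Its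
double series converges by uniform boundedness on Banach disks, and its sum is independent of the
representations because composing with an elementary tensor on either side is continuous on `E ⊗
E'`. -/

/-- Jacobi's formula for matrices of polynomials. -/
theorem Matrix.derivative_det_eq_trace {n R : Type*} [Fintype n] [DecidableEq n] [CommRing R]
    (P : Matrix n n R[X]) :
    derivative P.det = (P.adjugate * P.map derivative).trace := by
  -- Cramer's rule; the derivative of the determinant is the sum of these determinants, one for each
  -- differentiated column.
  have h : ∀ i : n, (P.updateCol i (fun j => derivative (P j i))).det
      = (P.adjugate * P.map derivative) i i := by
    intro i
    rw [← cramer_apply, cramer_eq_adjugate_mulVec]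
    rfl
  simp only [trace, diag_apply, ← h]
  simp only [det_apply, derivative_sum, Units.smul_def,
    zsmul_eq_mul, derivative_mul, derivative_intCast, zero_mul, zero_add]
  rw [Finset.sum_comm]
  refine Finset.sum_congr rfl fun σ _ => ?_
  rw [derivative_prod_finset, Finset.mul_sum]
  refine Finset.sum_congr rfl fun i _ => ?_
  rw [← Finset.mul_prod_erase univ _ (mem_univ i), updateCol_self, mul_comm (∏ _ ∈ _, _)]
  congr 2
  refine Finset.prod_congr rfl fun j hj => ?_
  rw [updateCol_ne (ne_of_mem_erase hj)]

/-- Newton's identities for the coefficients of `det (1 + X M)` and the traces of powers of `M`. -/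
theorem Matrix.succ_mul_coeff_det_one_add_X_smul {n R : Type*} [Fintype n] [DecidableEq n]
    [CommRing R] (M : Matrix n n R) (j : ℕ) :
    ((j : R) + 1) * (det (1 + (X : R[X]) • M.map C)).coeff (j + 1)
      = ∑ i ∈ range (j + 1), (-1) ^ i * (det (1 + (X : R[X]) • M.map C)).coeff (j - i)
          * (M ^ (i + 1)).trace := by
  set P : Matrix n n R[X] := 1 + (X : R[X]) • M.map C with hP
  have hmap : ∀ m, (M ^ m).map C = (M.map (C : R →+* R[X])) ^ m := fun m =>
    map_pow (C : R →+* R[X]).mapMatrix M m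
  have htr : ∀ m, ((M.map (C : R →+* R[X])) ^ m).trace = C (M ^ m).trace := by
    intro m; rw [← hmap]; simp [trace]
  -- This is the trace of `adj(P) P M^m = det(P) M^m` with `P = 1 + X M` expanded.
  have key : ∀ m, (P.adjugate * (M.map C) ^ m).trace + X * (P.adjugate * (M.map C) ^ (m + 1)).trace
      = P.det * C (M ^ m).trace := by
    intro m
    have h : P.adjugate * P * (M.map C) ^ m = P.det • (M.map C) ^ m := by
      rw [adjugate_mul]; simp
    have h2 := congrArg trace h
    rw [trace_smul, htr, smul_eq_mul] at h2
    rw [← h2]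
    conv_rhs => rw [hP, mul_add, add_mul, trace_add]
    rw [← hP]
    simp [pow_succ', mul_assoc, trace_smul]
  -- Comparing coefficients in `key` lowers the degree `j` by one and raises `m` by one, with a
  -- sign; iterating down to degree `0` gives the alternating sum. Jacobi's formula needs the case
  -- `m = 1`, since `P' = M`.
  have hcoeff : ∀ j m, (P.adjugate * (M.map C) ^ m).trace.coeff j
      = ∑ i ∈ range (j + 1), (-1) ^ i * P.det.coeff (j - i) * (M ^ (i + m)).trace := by
    intro j
    induction j with
    | zero =>
      intro m
      have := congrArg (fun q => Polynomial.coeff q 0) (key m)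
      simpa using this
    | succ j ih =>
      intro m
      have := congrArg (fun q => Polynomial.coeff q (j + 1)) (key m)
      simp only [coeff_add, coeff_X_mul, coeff_mul_C, ih] at this
      rw [eq_sub_of_add_eq this, Finset.sum_range_succ' _ (j + 1)]
      rw [sub_eq_neg_add, ← Finset.sum_neg_distrib]
      congr 1
      · refine Finset.sum_congr rfl fun i _ => ?_
        rw [Nat.succ_sub_succ, pow_succ, show i + (m + 1) = i + 1 + m by ring]; ring
      · simp
  have hd : P.map derivative = M.map C := by
    ext i k : 2
    by_cases hik : i = k <;> simp [hP, hik]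
  have h1 := congrArg (fun q => Polynomial.coeff q j) (Matrix.derivative_det_eq_trace P)
  simp only [hd, coeff_derivative] at h1
  have h2 := hcoeff j 1
  rw [pow_one] at h2
  rw [← h2, ← h1, mul_comm]

/-- A determinantal solution of Newton's recurrence. -/
theorem Matrix.det_newton_hessenberg {R : Type*} [CommRing R] (p c : ℕ → R) (h0 : c 0 = 1)
    (h : ∀ j : ℕ, ((j : R) + 1) * c (j + 1) = ∑ i ∈ range (j + 1), (-1) ^ i * c (j - i) * p i)
    (k : ℕ) :
    det (of fun i j : Fin k => if (j : ℕ) ≤ i then p (i - j)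
      else if (j : ℕ) = i + 1 then (k : R) - 1 - ((i : ℕ) : R) else 0) = (k.factorial : R) * c k := by
  rcases k with _ | n
  · simp [h0]
  set H : Matrix (Fin (n + 1)) (Fin (n + 1)) R := of fun i j =>
    if (j : ℕ) ≤ i then p (i - j) else if (j : ℕ) = i + 1 then ((i : ℕ) : R) + 1 else 0 with hH
  -- Transposing and reversing both index sets preserves the determinant and the diagonals, and
  -- turns the superdiagonal entry `n - i` into `i + 1`, the factor occurring in Newton's
  -- recurrence.
  have hdet : det (of fun i j : Fin (n + 1) => if (j : ℕ) ≤ i then p (i - j)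
      else if (j : ℕ) = i + 1 then ((n + 1 : ℕ) : R) - 1 - ((i : ℕ) : R) else 0) = det H := by
    rw [← det_transpose H, ← det_submatrix_equiv_self Fin.revPerm Hᵀ]
    congr 1
    ext i j
    have hi := i.2
    have hj := j.2
    simp only [hH, of_apply, submatrix_apply, transpose_apply, Fin.revPerm_apply, Fin.val_rev]
    have e1 : (n + 1 - ((i : ℕ) + 1) ≤ n + 1 - ((j : ℕ) + 1)) ↔ (j : ℕ) ≤ i := by omega
    have e2 : (n + 1 - ((i : ℕ) + 1) = n + 1 - ((j : ℕ) + 1) + 1) ↔ (j : ℕ) = i + 1 := by omega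
    simp only [e1, e2]
    split_ifs with h1 h2
    · congr 1; omega
    · have : n + 1 - ((j : ℕ) + 1) + (i + 1) = n := by omega
      have := congrArg (Nat.cast : ℕ → R) this
      push_cast at this ⊢
      linear_combination -this
    · rfl
  rw [hdet]
  have hsum : ∀ m, ∑ j ∈ range (m + 1), (-1) ^ j * c j * p (m - j)
      = (-1) ^ m * (((m : R) + 1) * c (m + 1)) := by
    intro m
    rw [h m, ← Finset.sum_range_reflect, Finset.mul_sum]
    refine Finset.sum_congr rfl fun i hi => ?_
    have hi' : i ≤ m := by simpa [Nat.lt_succ_iff] using hi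
    have e1 : m + 1 - 1 - i = m - i := by omega
    have e2 : m - (m - i) = i := by omega
    rw [e1, e2, ← mul_assoc, ← mul_assoc]
    congr 2
    have : (-1 : R) ^ m = (-1) ^ (m - i) * (-1) ^ i := by rw [← pow_add]; congr 1; omega
    rw [this, mul_assoc, ← mul_pow]; simp
  -- In row `i < n` the entries up to the diagonal contribute `(-1)^i (i+1) c_{i+1}`, which the
  -- superdiagonal entry cancels. The last row has no superdiagonal entry, so its contribution
  -- survives.
  have hcol : (fun i => ∑ j : Fin (n + 1), ((-1) ^ (j : ℕ) * c j) • H i j)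
      = fun i : Fin (n + 1) => if i = Fin.last n then (-1) ^ n * (((n : R) + 1) * c (n + 1)) else 0 := by
    funext i
    have hi := i.2
    simp only [hH, of_apply, smul_eq_mul]
    rw [Fin.sum_univ_eq_sum_range (fun j => (-1) ^ j * c j * (if j ≤ (i : ℕ) then p (i - j)
      else if j = i + 1 then ((i : ℕ) : R) + 1 else 0)) (n + 1)]
    have hle : ∀ i : ℕ, ∑ j ∈ range (i + 1), (-1) ^ j * c j * (if j ≤ i then p (i - j)
      else if j = i + 1 then (i : R) + 1 else 0) = (-1) ^ i * (((i : R) + 1) * c (i + 1)) := by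
      intro i
      rw [← hsum i]
      refine Finset.sum_congr rfl fun j hj => ?_
      rw [if_pos (by simpa [Nat.lt_succ_iff] using hj)]
    by_cases hil : i = Fin.last n
    · rw [if_pos hil, hil, Fin.val_last, hle]
    · rw [if_neg hil]
      have hin : (i : ℕ) < n := by
        have : (i : ℕ) ≠ n := fun hh => hil (Fin.ext hh)
        omega
      rw [← Finset.sum_subset (Finset.range_subset_range.2 (show (i : ℕ) + 1 + 1 ≤ n + 1 by omega)),
        Finset.sum_range_succ, hle, if_neg (by omega), if_pos rfl, pow_succ]
      · ring
      · intro j _ hj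
        have : ¬ j < (i : ℕ) + 1 + 1 := by simpa using hj
        rw [if_neg (by omega), if_neg (by omega), mul_zero]
  -- Column `0` has coefficient `c 0 = 1` in the combination, so replacing it by the combination
  -- leaves the determinant unchanged. Expansion along it leaves one lower triangular minor with
  -- diagonal `1, …, n`.
  have hup := det_updateCol_sum H 0 (fun j : Fin (n + 1) => (-1) ^ (j : ℕ) * c j)
  rw [hcol] at hup
  simp only [Fin.val_zero, pow_zero, h0, one_mul, one_smul] at hup
  rw [← hup, det_succ_column_zero, Finset.sum_eq_single (Fin.last n)]
  · have htri : ((H.updateCol 0 fun i : Fin (n + 1) =>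
        if i = Fin.last n then (-1) ^ n * (((n : R) + 1) * c (n + 1)) else 0).submatrix
          (Fin.last n).succAbove Fin.succ).det = (n.factorial : R) := by
      rw [det_of_isLowerTriangular]
      · have : ∀ i : Fin n, ((H.updateCol 0 fun i : Fin (n + 1) =>
          if i = Fin.last n then (-1) ^ n * (((n : R) + 1) * c (n + 1)) else 0).submatrix
          (Fin.last n).succAbove Fin.succ) i i = (((i : ℕ) + 1 : ℕ) : R) := by
          intro i
          simp [hH]
        rw [Finset.prod_congr rfl fun i _ => this i,
          Fin.prod_univ_eq_prod_range (fun i => ((i + 1 : ℕ) : R)) n, ← Nat.cast_prod,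
          Finset.prod_range_add_one_eq_factorial]
      · intro i j hij
        have hij' : (i : ℕ) < j := by simpa using hij
        simp [hH]
        rw [if_neg (by omega), if_neg (by omega)]
    rw [htri, updateCol_self, if_pos rfl, Fin.val_last, Nat.factorial_succ]
    have : ((-1 : R) ^ n) * (-1) ^ n = 1 := by rw [← mul_pow]; simp
    push_cast
    linear_combination ((n : R) + 1) * c (n + 1) * n.factorial * this
  · intro i _ hi
    rw [updateCol_self, if_neg hi]; simp
  · simp

/-- A form of Hadamard's inequality, for matrices with entries in the unit disc. -/
theorem Matrix.norm_det_sq_le_of_norm_entry_le_one {n : Type*} [Fintype n] [DecidableEq n]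
    (B : Matrix n n ℂ) (hB : ∀ i j, ‖B i j‖ ≤ 1) :
    ‖B.det‖ ^ 2 ≤ (Fintype.card n : ℝ) ^ Fintype.card n := by
  rcases isEmpty_or_nonempty n with hn | hn
  · simp
  have hpos : (0 : ℝ) < Fintype.card n := by exact_mod_cast Fintype.card_pos
  have hA : (Bᴴ * B).IsHermitian := isHermitian_conjTranspose_mul_self B
  have hev : ∀ i, 0 ≤ hA.eigenvalues i := eigenvalues_conjTranspose_mul_self_nonneg B
  have hdet : ‖B.det‖ ^ 2 = ∏ i, hA.eigenvalues i := by
    have h1 : (Bᴴ * B).det = ∏ i, (hA.eigenvalues i : ℂ) := hA.det_eq_prod_eigenvalues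
    rw [det_mul, det_conjTranspose] at h1
    have h2 : ‖star B.det * B.det‖ = ‖B.det‖ ^ 2 := by rw [norm_mul, norm_star, sq]
    rw [← h2, h1, norm_prod]
    refine Finset.prod_congr rfl fun i _ => ?_
    simp [abs_of_nonneg (hev i)]
  have htr : ∑ i, hA.eigenvalues i ≤ (Fintype.card n : ℝ) * Fintype.card n := by
    have h1 : (Bᴴ * B).trace = ∑ i, (hA.eigenvalues i : ℂ) := hA.trace_eq_sum_eigenvalues
    have h2 : ‖(Bᴴ * B).trace‖ ≤ (Fintype.card n : ℝ) * Fintype.card n := by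
      simp only [trace, diag_apply, mul_apply, conjTranspose_apply]
      refine (norm_sum_le_of_le _ fun i _ => norm_sum_le_of_le _ fun j _ =>
        (?_ : ‖star (B j i) * B j i‖ ≤ 1)).trans (by simp)
      rw [norm_mul, norm_star]
      exact mul_le_one₀ (hB _ _) (norm_nonneg _) (hB _ _)
    rw [h1, ← Complex.ofReal_sum, Complex.norm_real, Real.norm_of_nonneg
      (Finset.sum_nonneg fun i _ => hev i)] at h2
    exact h2
  -- The arithmetic-geometric mean inequality for the eigenvalues of `Bᴴ * B`, via `t ≤ exp (t - 1)`
  -- and trace at most `n²`.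
  have hprod : ∏ i, (hA.eigenvalues i / Fintype.card n) ≤ 1 := by
    calc ∏ i, (hA.eigenvalues i / Fintype.card n)
        ≤ ∏ i, Real.exp (hA.eigenvalues i / Fintype.card n - 1) :=
          Finset.prod_le_prod (fun i _ => div_nonneg (hev i) hpos.le) fun i _ => by
            have := Real.add_one_le_exp (hA.eigenvalues i / Fintype.card n - 1)
            linarith
      _ = Real.exp ((∑ i, hA.eigenvalues i) / Fintype.card n - Fintype.card n) := by
          rw [← Real.exp_sum, Finset.sum_sub_distrib, ← Finset.sum_div]; simp
      _ ≤ 1 := by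
          rw [Real.exp_le_one_iff, sub_nonpos, div_le_iff₀ hpos]; exact htr
  rw [Finset.prod_div_distrib, Finset.prod_const, Finset.card_univ, div_le_one (by positivity)]
    at hprod
  rwa [hdet]

/-- Hadamard's inequality for a matrix whose columns have bounded entries. -/
theorem Matrix.norm_det_le_of_norm_entry_le {n : Type*} [Fintype n] [DecidableEq n]
    (A : Matrix n n ℂ) (w : n → ℝ) (hA : ∀ i j, ‖A i j‖ ≤ w j) :
    ‖A.det‖ ≤ √((Fintype.card n : ℝ) ^ Fintype.card n) * ∏ j, w j := by
  by_cases hw : ∃ j, w j = 0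
  · obtain ⟨j, hj⟩ := hw
    rw [det_eq_zero_of_column_eq_zero j fun i => norm_le_zero_iff.1 ((hA i j).trans hj.le),
      Finset.prod_eq_zero (mem_univ j) hj]
    simp
  rcases isEmpty_or_nonempty n with hn | hn
  · simp
  push Not at hw
  have hwpos : ∀ j, 0 < w j := fun j =>
    lt_of_le_of_ne ((norm_nonneg _).trans (hA (Classical.arbitrary n) j)) (hw j).symm
  set B : Matrix n n ℂ := of fun i j => ((w j : ℂ))⁻¹ * A i j with hB
  have hAB : A = of fun i j => (w j : ℂ) * B i j := by
    ext i j
    have : (w j : ℂ) ≠ 0 := by exact_mod_cast hw j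
    simp [hB, this]
  have hdet : A.det = (∏ j, (w j : ℂ)) * B.det := by
    conv_lhs => rw [hAB]
    exact det_mul_row (fun j => (w j : ℂ)) B
  have h1 := norm_det_sq_le_of_norm_entry_le_one B fun i j => by
    rw [hB, of_apply, norm_mul, norm_inv, Complex.norm_real, Real.norm_of_nonneg (hwpos j).le,
      inv_mul_le_one₀ (hwpos j)]
    exact hA i j
  have h2 : ‖∏ j, (w j : ℂ)‖ = ∏ j, w j := by
    rw [norm_prod]
    exact Finset.prod_congr rfl fun j _ => by
      rw [Complex.norm_real, Real.norm_of_nonneg (hwpos j).le]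
  rw [hdet, norm_mul, h2, mul_comm]
  exact mul_le_mul_of_nonneg_right (Real.le_sqrt_of_sq_le h1)
    (Finset.prod_nonneg fun j _ => (hwpos j).le)

/-- Superadditivity of `t ↦ t ^ q` on `[0, ∞)`, iterated. -/
theorem Finset.sum_rpow_le_rpow_sum_of_one_le {ι : Type*} (s : Finset ι) (f : ι → ℝ)
    (hf : ∀ i, 0 ≤ f i) {q : ℝ} (hq : 1 ≤ q) : ∑ i ∈ s, f i ^ q ≤ (∑ i ∈ s, f i) ^ q := by
  classical
  induction s using Finset.induction_on with
  | empty => simp [Real.zero_rpow (by linarith : q ≠ 0)]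
  | insert a s ha ih =>
    rw [Finset.sum_insert ha, Finset.sum_insert ha]
    exact (add_le_add_right ih _).trans
      (Real.add_rpow_le_rpow_add (hf a) (Finset.sum_nonneg fun i _ => hf i) hq)

/-- After scaling by `k`, the elementary symmetric sum is part of the expansion of `∏ (1 + k a_i)`,
which is at most `exp (k ∑ a_i)`. The scaling produces the gain `k ^ (-k)`. -/
theorem Finset.sum_powersetCard_prod_le {ι : Type*} [Fintype ι] (a : ι → ℝ)
    (ha : ∀ i, 0 ≤ a i) (k : ℕ) :
    ∑ s ∈ univ.powersetCard k, ∏ i ∈ s, a i ≤ Real.exp (∑ i, a i) ^ k / (k : ℝ) ^ k := by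
  classical
  rcases Nat.eq_zero_or_pos k with rfl | hk
  · simp
  have hk' : (0 : ℝ) < k := by exact_mod_cast hk
  rw [le_div_iff₀ (by positivity), ← Real.exp_nat_mul]
  calc (∑ s ∈ univ.powersetCard k, ∏ i ∈ s, a i) * (k : ℝ) ^ k
      = ∑ s ∈ univ.powersetCard k, ∏ i ∈ s, (k * a i) := by
        rw [Finset.sum_mul]
        refine Finset.sum_congr rfl fun s hs => ?_
        rw [Finset.prod_mul_distrib, Finset.prod_const, (mem_powersetCard.1 hs).2, mul_comm]
    _ ≤ ∑ s ∈ univ.powerset, ∏ i ∈ s, (k * a i) :=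
        Finset.sum_le_sum_of_subset_of_nonneg (fun s _ => by simp)
          fun s _ _ => Finset.prod_nonneg fun i _ => mul_nonneg hk'.le (ha i)
    _ = ∏ i, (1 + k * a i) := (Finset.prod_one_add _).symm
    _ ≤ ∏ i, Real.exp (k * a i) :=
        Finset.prod_le_prod (fun i _ => by have := ha i; positivity) fun i _ => by
          rw [add_comm]; exact Real.add_one_le_exp _
    _ = Real.exp (k * ∑ i, a i) := by rw [← Real.exp_sum, Finset.mul_sum]

/-- The coefficient is the sum of the principal `k × k` minors. Hadamard costs `k ^ (k/2)` per
minor. Writing `∏ w = (∏ w ^ p) ^ (1/p)` and moving the power `1/p ≥ 1` outside the sum gains `k ^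
(-k/p)`. Finally `k! ≤ k ^ k`. -/
theorem Matrix.norm_coeff_det_one_add_X_smul_le {n : Type*} [Fintype n] [DecidableEq n]
    (M : Matrix n n ℂ) (w : n → ℝ) (hw : ∀ j, 0 ≤ w j) (hM : ∀ i j, ‖M i j‖ ≤ w j)
    {p : ℝ} (hp₀ : 0 < p) (hp₁ : p ≤ 1) (k : ℕ) :
    ‖(det (1 + (X : ℂ[X]) • M.map C)).coeff k‖
      ≤ Real.exp ((∑ j, w j ^ p) / p) ^ k / (k.factorial : ℝ) ^ (1 / p - 1 / 2) := by
  have hq : 1 ≤ 1 / p := by rw [le_div_iff₀ hp₀]; linarith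
  have hK : (0 : ℝ) < (k : ℝ) ^ k := by
    rcases Nat.eq_zero_or_pos k with rfl | hk
    · simp
    · have : (0 : ℝ) < k := by exact_mod_cast hk
      positivity
  have hfact : (k.factorial : ℝ) ≤ (k : ℝ) ^ k := by exact_mod_cast Nat.factorial_le_pow k
  have hfpos : (0 : ℝ) < k.factorial := by exact_mod_cast k.factorial_pos
  rw [coeff_det_one_add_X_smul_eq_sum_minors]
  have h1 : ‖∑ s ∈ Finset.univ.powersetCard k,
      (M.submatrix (Subtype.val : s → n) (Subtype.val : s → n)).det‖
      ≤ ∑ s ∈ Finset.univ.powersetCard k, √((k : ℝ) ^ k) * ∏ i ∈ s, w i := by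
    refine norm_sum_le_of_le _ fun s hs => ?_
    have := norm_det_le_of_norm_entry_le (M.submatrix (Subtype.val : s → n) (Subtype.val : s → n))
      (fun j => w j) fun i j => hM i j
    rw [Fintype.card_coe, (mem_powersetCard.1 hs).2] at this
    rwa [Finset.prod_coe_sort s w] at this
  have h2 : ∑ s ∈ Finset.univ.powersetCard k, ∏ i ∈ s, w i
      ≤ (Real.exp (∑ j, w j ^ p) ^ k / (k : ℝ) ^ k) ^ (1 / p) := by
    calc ∑ s ∈ Finset.univ.powersetCard k, ∏ i ∈ s, w i
        = ∑ s ∈ Finset.univ.powersetCard k, (∏ i ∈ s, w i ^ p) ^ (1 / p) := by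
          refine Finset.sum_congr rfl fun s _ => ?_
          rw [Real.finsetProd_rpow _ _ (fun i _ => hw i), ← Real.rpow_mul
            (Finset.prod_nonneg fun i _ => hw i), mul_one_div_cancel hp₀.ne', Real.rpow_one]
      _ ≤ (∑ s ∈ Finset.univ.powersetCard k, ∏ i ∈ s, w i ^ p) ^ (1 / p) :=
          Finset.sum_rpow_le_rpow_sum_of_one_le _ _
            (fun s => Finset.prod_nonneg fun i _ => Real.rpow_nonneg (hw i) _) hq
      _ ≤ _ := Real.rpow_le_rpow (Finset.sum_nonneg fun s _ =>
            Finset.prod_nonneg fun i _ => Real.rpow_nonneg (hw i) _)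
          (Finset.sum_powersetCard_prod_le _ (fun i => Real.rpow_nonneg (hw i) _) k) (by positivity)
  have h3 : √((k : ℝ) ^ k) * (Real.exp (∑ j, w j ^ p) ^ k / (k : ℝ) ^ k) ^ (1 / p)
      = Real.exp ((∑ j, w j ^ p) / p) ^ k / ((k : ℝ) ^ k) ^ (1 / p - 1 / 2) := by
    rw [Real.div_rpow (by positivity) hK.le, Real.sqrt_eq_rpow, Real.rpow_sub hK,
      ← Real.exp_nat_mul, ← Real.exp_mul, ← Real.exp_nat_mul]
    rw [mul_one_div, mul_div_assoc]
    have : 0 < ((k : ℝ) ^ k) ^ (1 / p) := by positivity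
    have : 0 < ((k : ℝ) ^ k) ^ (1 / 2 : ℝ) := by positivity
    field_simp
  refine h1.trans ?_
  rw [← Finset.mul_sum]
  refine (mul_le_mul_of_nonneg_left h2 (Real.sqrt_nonneg _)).trans ?_
  rw [h3]
  have hα : 0 ≤ 1 / p - 1 / 2 := by linarith
  gcongr

end MatrixDeterminants

/-! ### Entire functions with factorially decaying coefficients. -/

section EntireFunctions

open Filter Topology

/-- A geometric majorant of the terms of `∑ x ^ k / (k !) ^ α`. -/
theorem pow_div_factorial_rpow_le {α x : ℝ} (hα : 0 < α) (hx : 0 ≤ x) (k : ℕ) :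
    x ^ k / (k.factorial : ℝ) ^ α ≤ Real.exp (α * (2 * x) ^ α⁻¹) * (1 / 2) ^ k := by
  have hf : (0 : ℝ) < k.factorial := by exact_mod_cast k.factorial_pos
  -- Chosen so that `y ^ α = 2 x`: raising `y ^ k / k! ≤ exp y` to the power `α` then bounds `(2 x)
  -- ^ k / (k!) ^ α`, and the factor `2 ^ k` leaves a geometric series.
  set y : ℝ := (2 * x) ^ α⁻¹ with hy
  have hy0 : 0 ≤ y := by positivity
  have h1 : y ^ k / k.factorial ≤ Real.exp y := Real.pow_div_factorial_le_exp y hy0 k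
  have h2 := Real.rpow_le_rpow (by positivity) h1 hα.le
  have hyα : y ^ α = 2 * x := Real.rpow_inv_rpow (by positivity) hα.ne'
  have h3 : (y ^ k) ^ α = (2 * x) ^ k := by
    rw [← Real.rpow_natCast, ← Real.rpow_mul hy0, mul_comm (k : ℝ) α, Real.rpow_mul hy0, hyα,
      Real.rpow_natCast]
  rw [Real.div_rpow (by positivity) hf.le, h3, ← Real.exp_mul, mul_comm y α, mul_pow] at h2
  have h4 : x ^ k / (k.factorial : ℝ) ^ α = (2 ^ k * x ^ k / (k.factorial : ℝ) ^ α) * (1 / 2) ^ k := by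
    rw [one_div, inv_pow]; field_simp
  rw [h4]
  gcongr

variable {c : ℕ → ℂ} {K α : ℝ}

theorem norm_term_le_of_norm_coeff_le (hα : 0 < α) (hK : 0 ≤ K)
    (hc : ∀ k, ‖c k‖ ≤ K ^ k / (k.factorial : ℝ) ^ α) {r : ℝ} (hr : 0 ≤ r) {z : ℂ} (hz : ‖z‖ ≤ r)
    (k : ℕ) : ‖c k * z ^ k‖ ≤ Real.exp (α * (2 * (K * r)) ^ α⁻¹) * (1 / 2) ^ k := by
  refine le_trans ?_ (pow_div_factorial_rpow_le hα (mul_nonneg hK hr) k)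
  rw [norm_mul, norm_pow, mul_pow, mul_div_right_comm]
  have := hc k
  gcongr

theorem summable_of_norm_coeff_le (hα : 0 < α) (hK : 0 ≤ K)
    (hc : ∀ k, ‖c k‖ ≤ K ^ k / (k.factorial : ℝ) ^ α) (z : ℂ) :
    Summable fun k => c k * z ^ k :=
  Summable.of_norm_bounded (summable_geometric_two.mul_left _)
    (norm_term_le_of_norm_coeff_le hα hK hc (norm_nonneg z) le_rfl)

theorem differentiable_tsum_of_norm_coeff_le (hα : 0 < α) (hK : 0 ≤ K)
    (hc : ∀ k, ‖c k‖ ≤ K ^ k / (k.factorial : ℝ) ^ α) :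
    Differentiable ℂ fun z => ∑' k, c k * z ^ k := by
  intro z
  have h : DifferentiableOn ℂ (fun z => ∑' k, c k * z ^ k) (Metric.ball 0 (‖z‖ + 1)) :=
    Complex.differentiableOn_tsum_of_summable_norm
      (summable_geometric_two.mul_left (Real.exp (α * (2 * (K * (‖z‖ + 1))) ^ α⁻¹)))
      (fun k => ((differentiable_const _).mul (differentiable_id.pow k)).differentiableOn)
      Metric.isOpen_ball
      (fun k w hw => norm_term_le_of_norm_coeff_le hα hK hc (by positivity)
        (by simpa using (Metric.mem_ball.1 hw).le) k)
  exact h.differentiableAt (Metric.isOpen_ball.mem_nhds (by simp))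

theorem norm_tsum_le_of_norm_coeff_le (hα : 0 < α) (hK : 0 ≤ K)
    (hc : ∀ k, ‖c k‖ ≤ K ^ k / (k.factorial : ℝ) ^ α) {r : ℝ} (hr : 0 ≤ r) {z : ℂ} (hz : ‖z‖ = r) :
    ‖∑' k, c k * z ^ k‖ ≤ 2 * Real.exp (α * (2 * (K * r)) ^ α⁻¹) := by
  have h := tsum_of_norm_bounded (summable_geometric_two.mul_left _).hasSum
    (norm_term_le_of_norm_coeff_le hα hK hc hr hz.le)
  rwa [tsum_mul_left, tsum_geometric_two, mul_comm] at h

theorem QuatLCS.growthOrder_le_of_norm_coeff_le (hα : 0 < α) (hK : 0 ≤ K) (hc₀ : c 0 = 1)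
    (hc : ∀ k, ‖c k‖ ≤ K ^ k / (k.factorial : ℝ) ^ α) :
    QuatLCS.growthOrder (fun z => ∑' k, c k * z ^ k) ≤ ((α⁻¹ : ℝ) : EReal) := by
  set f : ℂ → ℂ := fun z => ∑' k, c k * z ^ k with hf
  -- With this constant `log M(r) ≤ A r ^ (1/α)` for `r > 1`; the summand `1` ensures `log A ≥ 0`.
  set A : ℝ := Real.log 2 + α * (2 * K) ^ α⁻¹ + 1 with hA
  have hA1 : 1 ≤ A := by
    have := Real.log_nonneg (one_le_two : (1 : ℝ) ≤ 2)
    have : 0 ≤ α * (2 * K) ^ α⁻¹ := by positivity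
    linarith
  have hbound : ∀ r : ℝ, 1 < r →
      Real.log (Real.log (QuatLCS.maxModulus f r)) / Real.log r ≤ α⁻¹ + Real.log A / Real.log r := by
    intro r hr
    have hr0 : 0 < r := by linarith
    have hlr : 0 < Real.log r := Real.log_pos hr
    have hsphere : ∀ z ∈ Metric.sphere (0 : ℂ) r,
        ‖f z‖ ≤ 2 * Real.exp (α * (2 * (K * r)) ^ α⁻¹) := fun z hz =>
      norm_tsum_le_of_norm_coeff_le hα hK hc hr0.le (by simpa using hz)
    have hM : QuatLCS.maxModulus f r ≤ 2 * Real.exp (α * (2 * (K * r)) ^ α⁻¹) := by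
      refine Real.sSup_le ?_ (by positivity)
      rintro _ ⟨z, hz, rfl⟩
      exact hsphere z hz
    -- The maximum principle and `f 0 = 1`. This excludes `log M(r) < 0`, where `Real.log` would
    -- take the logarithm of the absolute value.
    have hM1 : 1 ≤ QuatLCS.maxModulus f r := by
      have h0 : ‖f 0‖ = 1 := by
        have : f 0 = c 0 := by
          rw [hf]
          refine (tsum_eq_single 0 fun k hk => by simp [hk]).trans (by simp)
        rw [this, hc₀, norm_one]
      rw [← h0]
      refine Complex.norm_le_of_forall_mem_frontier_norm_le (U := Metric.ball 0 r)
        Metric.isBounded_ball (differentiable_tsum_of_norm_coeff_le hα hK hc).diffContOnCl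
        (fun z hz => ?_) (subset_closure (Metric.mem_ball_self hr0))
      rw [frontier_ball _ hr0.ne'] at hz
      exact le_csSup ⟨_, Set.forall_mem_image.2 hsphere⟩ (Set.mem_image_of_mem _ hz)
    have hrr : 1 ≤ r ^ α⁻¹ := Real.one_le_rpow hr.le (by positivity)
    have hAr : 1 ≤ A * r ^ α⁻¹ := by nlinarith
    have hlogA : Real.log (A * r ^ α⁻¹) = Real.log A + α⁻¹ * Real.log r := by
      rw [Real.log_mul (by positivity) (by positivity), Real.log_rpow hr0]
    have hnn : 0 ≤ Real.log (A * r ^ α⁻¹) := Real.log_nonneg hAr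
    have hlogM : Real.log (QuatLCS.maxModulus f r) ≤ A * r ^ α⁻¹ := by
      refine (Real.log_le_log (by linarith) hM).trans ?_
      rw [Real.log_mul two_ne_zero (Real.exp_ne_zero _), Real.log_exp, ← mul_assoc,
        Real.mul_rpow (by positivity) hr0.le]
      have h2 := Real.log_nonneg (one_le_two : (1 : ℝ) ≤ 2)
      rw [hA]
      nlinarith
    have hfin : Real.log (Real.log (QuatLCS.maxModulus f r)) ≤ Real.log A + α⁻¹ * Real.log r := by
      rw [← hlogA]
      -- If `M(r) = 1`, the iterated logarithm takes the default value `Real.log 0 = 0`.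
      rcases hM1.eq_or_lt with h1 | h1
      · rw [← h1, Real.log_one, Real.log_zero]; exact hnn
      · exact Real.log_le_log (Real.log_pos h1) hlogM
    rw [div_le_iff₀ hlr, add_mul, div_mul_cancel₀ _ hlr.ne']
    linarith
  have hlim : Tendsto (fun r : ℝ => α⁻¹ + Real.log A / Real.log r) atTop (𝓝 α⁻¹) := by
    simpa using tendsto_const_nhds.add (tendsto_const_nhds.div_atTop Real.tendsto_log_atTop)
  have hlim' : Tendsto (fun r : ℝ => ((α⁻¹ + Real.log A / Real.log r : ℝ) : EReal)) atTop
      (𝓝 ((α⁻¹ : ℝ) : EReal)) := (continuous_coe_real_ereal.tendsto _).comp hlim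
  rw [QuatLCS.growthOrder, ← hlim'.limsup_eq]
  refine limsup_le_limsup ?_
  filter_upwards [eventually_gt_atTop 1] with r hr
  exact_mod_cast hbound r hr

end EntireFunctions

/-! ### Uniform boundedness for seminorms. -/

section UniformBoundedness

open Filter Topology

/-- The uniform boundedness principle for seminorms on a complete seminormed space. -/
theorem Seminorm.exists_le_mul_of_pointwise_bounded {V ι : Type*} [AddCommGroup V] [Module ℝ V]
    (s : Seminorm ℝ V)
    (hs : ∀ u : ℕ → V, (∀ ε : ℝ, 0 < ε → ∃ N, ∀ m ≥ N, ∀ n ≥ N, s (u m - u n) < ε) →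
      ∃ x, ∀ ε : ℝ, 0 < ε → ∃ N, ∀ n ≥ N, s (u n - x) < ε)
    (q : ι → Seminorm ℝ V) (hq : ∀ i, ∃ C, ∀ x, q i x ≤ C * s x)
    (hb : ∀ x, ∃ C, ∀ i, q i x ≤ C) : ∃ C, ∀ i x, q i x ≤ C * s x := by
  let _ : SeminormedAddCommGroup V := s.toSeminormedAddCommGroup
  let _ : NormedSpace ℝ V := ⟨fun a x => (map_smul_eq_mul s a x).le⟩
  have hnorm : ∀ x : V, ‖x‖ = s x := fun _ => rfl
  have : CompleteSpace V := by
    refine EMetric.complete_of_cauchySeq_tendsto fun u hu => ?_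
    rw [Metric.cauchySeq_iff] at hu
    obtain ⟨x, hx⟩ := hs u fun ε hε => by
      obtain ⟨N, hN⟩ := hu ε hε
      exact ⟨N, fun m hm n hn => by simpa [dist_eq_norm, hnorm] using hN m hm n hn⟩
    refine ⟨x, Metric.tendsto_atTop.2 fun ε hε => ?_⟩
    obtain ⟨N, hN⟩ := hx ε hε
    exact ⟨N, fun n hn => by simpa [dist_eq_norm, hnorm] using hN n hn⟩
  have hbdd : BddAbove (Set.range q) := by
    rw [Seminorm.bddAbove_range_iff]
    intro x
    obtain ⟨C, hC⟩ := hb x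
    exact ⟨C, by rintro _ ⟨i, rfl⟩; exact hC i⟩
  -- A complete seminormed space is barrelled, so a pointwise bounded supremum of continuous
  -- seminorms is continuous.
  have hcont : Continuous (⇑(⨆ i, q i)) := by
    rw [Seminorm.coe_iSup_eq hbdd]
    refine Seminorm.continuous_iSup q (fun i => ?_) hbdd
    obtain ⟨C, hC⟩ := hq i
    refine Seminorm.continuous_of_le (q := C.toNNReal • s) ?_ fun x => ?_
    · exact continuous_const.mul continuous_norm
    · exact (hC x).trans (mul_le_mul_of_nonneg_right (Real.le_coe_toNNReal C) (apply_nonneg s x))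
  obtain ⟨C, _, hC⟩ := Seminorm.bound_of_continuous_normedSpace _ hcont
  exact ⟨C, fun i x => (Seminorm.le_def.1 (le_ciSup hbdd i) x).trans (hC x)⟩

end UniformBoundedness

namespace QuatLCS

/-! ### Uniform boundedness on Banach disks. -/

section BanachDisks

open Filter Topology Pointwise

variable {K : Type*} [NormedRing K] [NormedAlgebra ℝ K] [NormOneClass K] {V : Type*}
  [AddCommGroup V] [Module ℝ V] [Module K V] [IsScalarTower ℝ K V] {B : Set V}

theorem balanced_real_of_balanced (hB : Balanced K B) : Balanced ℝ B := by
  rintro a ha _ ⟨x, hx, rfl⟩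
  have h := hB (a • (1 : K)) (by rw [norm_smul, norm_one, mul_one]; exact ha)
    (Set.smul_mem_smul_set hx)
  simpa [smul_assoc] using h

/-- Convexity handles sums of dilates of `B`, and balancedness over `K` absorbs scalars of `K` into
real dilations. Hence the gauge of `B` is finite on its `K`-span. -/
theorem exists_mem_smul_of_mem_span (hB : Balanced K B) (hc : Convex ℝ B) (hne : B.Nonempty) {x : V}
    (hx : x ∈ Submodule.span K B) : ∃ t : ℝ, 0 < t ∧ x ∈ t • B := by
  have : SMulCommClass ℝ K V := IsScalarTower.to_smulCommClass
  have h0 : (0 : V) ∈ B := hB.zero_mem hne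
  induction hx using Submodule.span_induction with
  | mem x hx => exact ⟨1, one_pos, by simpa using hx⟩
  | zero => exact ⟨1, one_pos, by simpa using h0⟩
  | add x y _ _ hx hy =>
    obtain ⟨t, ht, hx⟩ := hx
    obtain ⟨r, hr, hy⟩ := hy
    exact ⟨t + r, add_pos ht hr, by
      rw [hc.add_smul ht.le hr.le]; exact Set.add_mem_add hx hy⟩
  | smul k x _ hx =>
    obtain ⟨t, ht, b, hb, rfl⟩ := hx
    have hk : (0 : ℝ) < ‖k‖ + 1 := by positivity
    refine ⟨t * (‖k‖ + 1), by positivity, ((‖k‖ + 1)⁻¹ • k) • b, ?_, ?_⟩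
    · refine hB _ ?_ (Set.smul_mem_smul_set hb)
      rw [norm_smul, norm_inv, Real.norm_of_nonneg hk.le, inv_mul_le_one₀ hk]
      linarith
    · change (t * (‖k‖ + 1)) • ((‖k‖ + 1)⁻¹ • k) • b = k • t • b
      rw [smul_assoc, smul_smul, mul_assoc, mul_inv_cancel₀ hk.ne', mul_one, smul_comm]

/-- A family of seminorms, each bounded on a Banach disk and pointwise bounded, is uniformly bounded
on the disk. -/
theorem IsBanachDisk.exists_forall_seminorm_le [TopologicalSpace V] (hB : IsBanachDisk K B)
    {ι : Type*} (q : ι → Seminorm ℝ V) (hq : ∀ i, ∃ C, ∀ x ∈ B, q i x ≤ C)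
    (hb : ∀ x, ∃ C, ∀ i, q i x ≤ C) : ∃ C, ∀ i, ∀ x ∈ B, q i x ≤ C := by
  rcases B.eq_empty_or_nonempty with rfl | hne
  · exact ⟨0, by simp⟩
  set W : Submodule ℝ V := (Submodule.span K B).restrictScalars ℝ with hW
  have hBW : ∀ x ∈ B, x ∈ W := fun x hx => Submodule.subset_span hx
  set D : Set W := W.subtype ⁻¹' B with hD
  have hmem : ∀ (t : ℝ) (x : W), x ∈ t • D ↔ (x : V) ∈ t • B := by
    intro t x
    constructor
    · rintro ⟨b, hb, rfl⟩
      exact ⟨b, hb, rfl⟩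
    · rintro ⟨b, hb, h⟩
      exact ⟨⟨b, hBW b hb⟩, hb, Subtype.ext h⟩
  have hgauge : ∀ x : W, gauge D x = gauge B (x : V) := by
    intro x
    simp only [gauge, hmem]
  have habs : ∀ x : W, ∃ t : ℝ, 0 < t ∧ x ∈ t • D := by
    intro x
    obtain ⟨t, ht, hx⟩ := exists_mem_smul_of_mem_span hB.balanced hB.convex hne x.2
    exact ⟨t, ht, (hmem t x).2 hx⟩
  have hDb : Balanced ℝ D := by
    rintro a ha _ ⟨x, hx, rfl⟩
    exact balanced_real_of_balanced hB.balanced a ha (Set.smul_mem_smul_set hx)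
  have hDc : Convex ℝ D := hB.convex.linear_preimage W.subtype
  have hDa : Absorbent ℝ D := by
    intro x
    obtain ⟨t, ht, hx⟩ := habs x
    refine Absorbs.of_norm ⟨t, fun c hc => ?_⟩
    rw [Set.singleton_subset_iff]
    exact hDb.smul_mono (by simpa [abs_of_pos ht] using hc) hx
  -- A bound on `B` becomes a bound by the gauge by homogeneity; `|C| + 1` is a positive constant
  -- above `C`, so one can divide by it.
  have hle : ∀ (p : Seminorm ℝ V) (C : ℝ), (∀ x ∈ B, p x ≤ C) →
      ∀ x : W, p x ≤ (|C| + 1) * gauge D x := by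
    intro p C hC x
    have hC1 : 0 < |C| + 1 := by positivity
    rw [← div_le_iff₀' hC1]
    refine le_csInf (by obtain ⟨t, ht, hx⟩ := habs x; exact ⟨t, ht, hx⟩) ?_
    rintro t ⟨ht, b, hb, rfl⟩
    rw [div_le_iff₀ hC1]
    have h1 : p ((t • b : W) : V) = t * p b := by
      rw [Submodule.coe_smul, map_smul_eq_mul, Real.norm_of_nonneg (le_of_lt ht)]
    have h2 := hC b hb
    have h3 := le_abs_self C
    change p ((t • b : W) : V) ≤ _
    rw [h1]
    exact mul_le_mul_of_nonneg_left (by linarith) (le_of_lt ht)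
  obtain ⟨C, hC⟩ := Seminorm.exists_le_mul_of_pointwise_bounded (gaugeSeminorm hDb hDc hDa)
    (fun u hu => by
      obtain ⟨x, hx, hlim⟩ := hB.complete (fun n => (u n : V)) (fun n => (u n).2) fun ε hε => by
        obtain ⟨N, hN⟩ := hu ε hε
        refine ⟨N, fun m hm n hn => ?_⟩
        simpa [hgauge] using hN m hm n hn
      refine ⟨⟨x, hx⟩, fun ε hε => ?_⟩
      obtain ⟨N, hN⟩ := hlim ε hε
      refine ⟨N, fun n hn => ?_⟩
      simpa [hgauge] using hN n hn)
    (fun i => (q i).comp W.subtype)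
    (fun i => by
      obtain ⟨C, hC⟩ := hq i
      exact ⟨_, hle (q i) C hC⟩)
    (fun x => hb x)
  refine ⟨|C|, fun i x hx => ?_⟩
  have h1 := hC i ⟨x, hBW x hx⟩
  have h2 : gauge D ⟨x, hBW x hx⟩ ≤ 1 := gauge_le_one_of_mem hx
  have h3 : 0 ≤ gauge D ⟨x, hBW x hx⟩ := gauge_nonneg _
  change q i x ≤ C * gauge D ⟨x, hBW x hx⟩ at h1
  nlinarith [le_abs_self C, abs_nonneg C]

end BanachDisks

/-- An absolutely homogeneous function which is less than `1` near the origin is bounded above on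
bounded sets. -/
theorem exists_forall_le_of_isVonNBounded {F : Type*} [AddCommGroup F] [Module ℝ F]
    [TopologicalSpace F] {S : Set F} (hS : Bornology.IsVonNBounded ℝ S) (g : F → ℝ)
    (hg : {y | g y < 1} ∈ nhds (0 : F)) (hh : ∀ (c : ℝ) y, g (c • y) = |c| * g y) :
    ∃ C, ∀ y ∈ S, g y ≤ C := by
  obtain ⟨r, hr⟩ := absorbs_iff_norm.1 (hS hg)
  refine ⟨|r| + 1, fun y hy => ?_⟩
  obtain ⟨z, hz, rfl⟩ := hr (|r| + 1)
    (by rw [Real.norm_of_nonneg (by positivity)]; linarith [le_abs_self r]) hy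
  have hz' : g z < 1 := hz
  change g ((|r| + 1) • z) ≤ _
  rw [hh, abs_of_nonneg (by positivity)]
  nlinarith [abs_nonneg r]

/-! ### Convergence of series in the inductive tensor product. -/

section InductiveTensor

open Filter Topology

variable {E F : Type*} [AddCommGroup E] [Module ℝ E] [Module ℍ[ℝ]ᵐᵒᵖ E]
  [IsScalarTower ℝ ℍ[ℝ]ᵐᵒᵖ E] [TopologicalSpace E]
  [AddCommGroup F] [Module ℝ F] [Module ℍ[ℝ] F] [TopologicalSpace F]

theorem qtmul_add_left (x y : E) (f : F) : qtmul (x + y) f = qtmul x f + qtmul y f := by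
  simp [qtmul, TensorProduct.add_tmul]; rfl

theorem qtmul_add_right (x : E) (f g : F) : qtmul x (f + g) = qtmul x f + qtmul x g := by
  simp [qtmul, TensorProduct.tmul_add]; rfl

theorem qtmul_smul_left (c : ℝ) (x : E) (f : F) : qtmul (c • x) f = c • qtmul x f := by
  simp [qtmul]; rfl

theorem qtmul_smul_right (c : ℝ) (x : E) (f : F) : qtmul x (c • f) = c • qtmul x f := by
  simp [qtmul]; rfl

/-- A separately continuous balanced bilinear map into a locally convex space induces a
continuous map on `E ⊗ F`. -/
theorem QTensor.continuous_lift_of_separately {M : Type*} [AddCommGroup M] [Module ℝ M]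
    [TopologicalSpace M] [IsTopologicalAddGroup M] [ContinuousSMul ℝ M] [LocallyConvexSpace ℝ M]
    (Φ : E →ₗ[ℝ] F →ₗ[ℝ] M)
    (hΦ : ∀ x (q : ℍ[ℝ]) y, Φ (x <• q) y = Φ x (q • y))
    (h₁ : ∀ y, Continuous fun x => Φ x y) (h₂ : ∀ x, Continuous fun y => Φ x y) :
    Continuous (QTensor.lift Φ hΦ) := by
  rw [continuous_iff_le_induced]
  refine sInf_le ⟨topologicalAddGroup_induced _, continuousSMul_induced _,
    LocallyConvexSpace.induced _, fun y => ?_, fun x => ?_⟩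
  · rw [continuous_induced_rng]; simpa [Function.comp_def] using h₁ y
  · rw [continuous_induced_rng]; simpa [Function.comp_def] using h₂ x

/-- The elementary tensors of a Banach disk and a bounded set form a bounded set. -/
theorem exists_forall_seminorm_qtmul_le {B : Set E} (hB : IsBanachDisk ℍ[ℝ]ᵐᵒᵖ B) {B' : Set F}
    (hB' : Bornology.IsVonNBounded ℝ B') (q : Seminorm ℝ (QTensor E F)) (hq : Continuous q) :
    ∃ C, ∀ x ∈ B, ∀ y ∈ B', q (qtmul x y) ≤ C := by
  have hopen : {t | q t < 1} ∈ 𝓝 (0 : QTensor E F) :=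
    hq.continuousAt.preimage_mem_nhds (Iio_mem_nhds (by rw [map_zero]; exact one_pos))
  obtain ⟨-, -, -, hl, hr⟩ := isAdmissible_inductive (E := E) (F := F)
  have hx0 : ∀ y : F, qtmul (0 : E) y = 0 := fun y => by simpa using qtmul_smul_left 0 (0 : E) y
  have h0y : ∀ x : E, qtmul x (0 : F) = 0 := fun x => by simpa using qtmul_smul_right 0 x (0 : F)
  let T : F → E →ₗ[ℝ] QTensor E F := fun y =>
    { toFun := fun x => qtmul x y
      map_add' := fun x x' => qtmul_add_left x x' y
      map_smul' := fun c x => qtmul_smul_left c x y }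
  -- Uniform boundedness for the seminorms `x ↦ q (x ⊗ y)`, `y ∈ B'`: continuity in `x` bounds each
  -- on `B`, and continuity in `y` bounds the family at each `x`. Separate continuity thus suffices.
  obtain ⟨C, hC⟩ := hB.exists_forall_seminorm_le (fun y : B' => q.comp (T y))
    (fun y => exists_forall_le_of_isVonNBounded hB.bounded _
      ((hl y).continuousAt.preimage_mem_nhds (by rw [hx0]; exact hopen))
      fun c x => map_smul_eq_mul (q.comp (T y)) c x)
    (fun x => by
      obtain ⟨C, hC⟩ := exists_forall_le_of_isVonNBounded hB' (fun y => q (qtmul x y))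
        ((hr x).continuousAt.preimage_mem_nhds (by rw [h0y]; exact hopen))
        (fun c y => by rw [qtmul_smul_right, map_smul_eq_mul, Real.norm_eq_abs])
      exact ⟨C, fun y => hC y y.2⟩)
  exact ⟨C, fun x hx y hy => hC ⟨y, hy⟩ x hx⟩

/-- Absolutely summable combinations of elementary tensors with factors in a Banach disk and in a
bounded set converge in the inductive tensor product. -/
theorem summable_smul_itmul {ι : Type*} {a : ι → ℝ} (ha : Summable fun i => |a i|) {e : ι → E}
    {f : ι → F} {B : Set E} (hB : IsBanachDisk ℍ[ℝ]ᵐᵒᵖ B) {B' : Set F}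
    (hB' : Bornology.IsVonNBounded ℝ B') (he : ∀ i, e i ∈ B) (hf : ∀ i, f i ∈ B') :
    Summable fun i => a i • itmul (e i) (f i) := by
  have hc : CauchySeq fun s : Finset ι => ∑ i ∈ s, a i • qtmul (e i) (f i) := by
    rw [cauchySeq_finset_iff_sum_vanishing]
    intro U hU
    obtain ⟨S, hS, hSU⟩ := (nhds_hasBasis_absConvex_open ℝ (QTensor E F)).mem_iff.1 hU
    let S' : AbsConvexOpenSets ℝ (QTensor E F) := ⟨S, hS⟩
    have hball : (gaugeSeminormFamily ℝ (QTensor E F) S').ball 0 1 = S := gaugeSeminormFamily_ball S'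
    have hcont := (with_gaugeSeminormFamily (𝕜 := ℝ) (E := QTensor E F)).continuous_seminorm S'
    set q := gaugeSeminormFamily ℝ (QTensor E F) S'
    obtain ⟨C, hC⟩ := exists_forall_seminorm_qtmul_le hB hB' q hcont
    have hC1 : 0 < |C| + 1 := by positivity
    obtain ⟨s, hs⟩ := summable_iff_vanishing.1 ha (Metric.ball 0 (|C| + 1)⁻¹)
      (Metric.ball_mem_nhds _ (by positivity))
    refine ⟨s, fun t ht => hSU ?_⟩
    simp only [id]
    rw [← hball, Seminorm.mem_ball_zero]
    have h1 := hs t ht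
    rw [mem_ball_zero_iff, Real.norm_of_nonneg (Finset.sum_nonneg fun _ _ => abs_nonneg _),
      ← one_div, lt_div_iff₀ hC1] at h1
    calc q (∑ i ∈ t, a i • qtmul (e i) (f i)) ≤ ∑ i ∈ t, q (a i • qtmul (e i) (f i)) :=
          Finset.le_sum_of_subadditive q (map_zero q).le (map_add_le_add q) _ _
      _ ≤ ∑ i ∈ t, |a i| * (|C| + 1) := Finset.sum_le_sum fun i _ => by
          rw [map_smul_eq_mul, Real.norm_eq_abs]
          have := hC _ (he i) _ (hf i)
          exact mul_le_mul_of_nonneg_left (by linarith [le_abs_self C]) (abs_nonneg _)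
      _ < 1 := by rwa [← Finset.sum_mul]
  have h2 : CauchySeq fun s : Finset ι =>
      ((∑ i ∈ s, a i • qtmul (e i) (f i) : QTensor E F) : IndTensor E F) :=
    hc.map (UniformSpace.Completion.uniformContinuous_coe (QTensor E F))
  have h3 : ∀ s : Finset ι, ((∑ i ∈ s, a i • qtmul (e i) (f i) : QTensor E F) : IndTensor E F)
      = ∑ i ∈ s, a i • itmul (e i) (f i) := by
    intro s
    refine (map_sum (UniformSpace.Completion.toCompl (α := QTensor E F)) _ s).trans ?_
    exact Finset.sum_congr rfl fun i _ => UniformSpace.Completion.coe_smul _ _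
  simp only [h3] at h2
  exact summable_iff_cauchySeq_finset.2 h2

end InductiveTensor

end QuatLCS

noncomputable section

namespace QuatLCS

/-! ### Composition of Fredholm kernels is well defined. -/

section Composition

open Filter Topology

variable {E : Type*} [AddCommGroup E] [Module ℝ E] [Module ℍ[ℝ]ᵐᵒᵖ E]
  [IsScalarTower ℝ ℍ[ℝ]ᵐᵒᵖ E] [TopologicalSpace E]

theorem continuousSMul_real [ContinuousSMul ℍ[ℝ]ᵐᵒᵖ E] : ContinuousSMul ℝ E :=
  IsScalarTower.continuousSMul ℍ[ℝ]ᵐᵒᵖ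

theorem QDual.map_smul_right (f : QDual E) (x : E) (q : ℍ[ℝ]) : f (x <• q) = f x * q := by
  rw [map_smul, MulOpposite.smul_eq_mul_unop, MulOpposite.unop_op]

theorem QDual.map_real_smul (f : QDual E) (c : ℝ) (x : E) : f (c • x) = c • f x := by
  rw [← one_smul ℍ[ℝ]ᵐᵒᵖ x, ← smul_assoc, map_smul, map_smul, one_smul]
  simp

theorem smul_op_eq (c : ℝ) (x : E) (q : ℍ[ℝ]) : (c • x) <• q = c • (x <• q) := by
  have : SMulCommClass ℝ ℍ[ℝ]ᵐᵒᵖ E := IsScalarTower.to_smulCommClass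
  exact (smul_comm c (MulOpposite.op q) x).symm

theorem op_real_smul (c : ℝ) (x : E) (q : ℍ[ℝ]) : x <• (c • q) = c • (x <• q) := by
  rw [MulOpposite.op_smul, smul_assoc]

theorem mem_of_balanced {B : Set E} (hB : Balanced ℍ[ℝ]ᵐᵒᵖ B) {y : E} (hy : y ∈ B) {q : ℍ[ℝ]}
    (hq : ‖q‖ ≤ 1) : y <• q ∈ B :=
  hB (MulOpposite.op q) hq (Set.smul_mem_smul_set hy)

/-- The pairing of bounded subsets of `E` and of its strong dual is bounded. -/
theorem QDual.exists_forall_norm_apply_le {B : Set E} (hB : Bornology.IsVonNBounded ℝ B)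
    {B' : Set (QDual E)} (hB' : Bornology.IsVonNBounded ℝ B') :
    ∃ C : ℝ, 0 < C ∧ ∀ f ∈ B', ∀ x ∈ B, ‖f x‖ ≤ C := by
  have hU : {f : QDual E | ∀ x ∈ B, ‖f x‖ < 1} ∈ 𝓝 (0 : QDual E) := by
    rw [nhds_induced]
    refine ⟨_, UniformOnFun.gen_mem_nhds (𝔖 := {S : Set E | Bornology.IsVonNBounded ℝ S}) ℍ[ℝ] _ hB
      (Metric.dist_mem_uniformity one_pos), ?_⟩
    intro f hf x hx
    have h : dist (0 : ℍ[ℝ]) (f x) < 1 := hf x hx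
    rwa [dist_comm, dist_zero_right] at h
  obtain ⟨r, hr⟩ := absorbs_iff_norm.1 (hB' hU)
  refine ⟨|r| + 1, by positivity, fun f hf x hx => ?_⟩
  obtain ⟨g, hg, rfl⟩ := hr (|r| + 1)
    (by rw [Real.norm_of_nonneg (by positivity)]; linarith [le_abs_self r]) hf
  have hg' : ‖g x‖ < 1 := hg x hx
  change ‖(|r| + 1) • g x‖ ≤ _
  rw [norm_smul, Real.norm_of_nonneg (by positivity)]
  nlinarith [abs_nonneg r]

/-- For fixed `x` and `x'`, the map `y ⊗ y' ↦ (y ⟨y', x⟩) ⊗ x'`. -/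
def composeRight (x : E) (x' : QDual E) : QTensor E (QDual E) →ₗ[ℝ] QTensor E (QDual E) :=
  QTensor.lift (LinearMap.mk₂ ℝ (fun y (y' : QDual E) => qtmul (y <• y' x) x')
      (fun y z y' => by rw [smul_add, qtmul_add_left])
      (fun c y y' => by rw [smul_op_eq, qtmul_smul_left])
      (fun y y' z' => by
        rw [add_apply, MulOpposite.op_add, add_smul, qtmul_add_left])
      (fun c y y' => by
        rw [smul_apply, op_real_smul, qtmul_smul_left]))
    (fun y q y' => by
      simp only [LinearMap.mk₂_apply, smul_apply, smul_eq_mul,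
        MulOpposite.op_mul, mul_smul])

/-- For fixed `y` and `y'`, the map `x ⊗ x' ↦ (y ⟨y', x⟩) ⊗ x'`. -/
def composeLeft (y : E) (y' : QDual E) : QTensor E (QDual E) →ₗ[ℝ] QTensor E (QDual E) :=
  QTensor.lift (LinearMap.mk₂ ℝ (fun x (x' : QDual E) => qtmul (y <• y' x) x')
      (fun x z x' => by rw [map_add, MulOpposite.op_add, add_smul, qtmul_add_left])
      (fun c x x' => by rw [QDual.map_real_smul, op_real_smul, qtmul_smul_left])
      (fun x x' z' => qtmul_add_right _ _ _)
      (fun c x x' => qtmul_smul_right _ _ _))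
    (fun x q x' => by
      simp only [LinearMap.mk₂_apply]
      rw [QDual.map_smul_right, MulOpposite.op_mul, mul_smul, qtmul_balanced])

@[simp]
theorem composeRight_qtmul (x : E) (x' : QDual E) (y : E) (y' : QDual E) :
    composeRight x x' (qtmul y y') = qtmul (y <• y' x) x' :=
  QTensor.lift_qtmul _ _ _ _

@[simp]
theorem composeLeft_qtmul (x : E) (x' : QDual E) (y : E) (y' : QDual E) :
    composeLeft y y' (qtmul x x') = qtmul (y <• y' x) x' :=
  QTensor.lift_qtmul _ _ _ _

variable [ContinuousSMul ℍ[ℝ]ᵐᵒᵖ E]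

theorem continuous_composeRight (x : E) (x' : QDual E) : Continuous (composeRight x x') := by
  have := continuousSMul_real (E := E)
  obtain ⟨-, -, -, hl, hr⟩ := isAdmissible_inductive (E := E) (F := QDual E)
  refine QTensor.continuous_lift_of_separately _ _ (fun y' => ?_) fun y => ?_
  · exact (hl x').comp (continuous_const_smul (MulOpposite.op (y' x)))
  · exact (hl x').comp ((MulOpposite.continuous_op.comp (QDual.continuous_eval x)).smul
      continuous_const)

theorem continuous_composeLeft (y : E) (y' : QDual E) : Continuous (composeLeft y y') := by
  obtain ⟨-, -, -, hl, hr⟩ := isAdmissible_inductive (E := E) (F := QDual E)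
  refine QTensor.continuous_lift_of_separately _ _ (fun x' => ?_) fun x => hr _
  exact (hl x').comp ((MulOpposite.continuous_op.comp y'.continuous).smul continuous_const)

/-- A continuous linear endomorphism of `E ⊗ E'` acts termwise on convergent sums. -/
theorem hasSum_completion_map {ι : Type*} (T : QTensor E (QDual E) →ₗ[ℝ] QTensor E (QDual E))
    (hT : Continuous T) {a : ι → ℝ} {e : ι → E} {f : ι → QDual E} {u : IndTensor E (QDual E)}
    (h : HasSum (fun i => a i • itmul (e i) (f i)) u) :
    HasSum (fun i => a i • ((T (qtmul (e i) (f i)) : QTensor E (QDual E)) : IndTensor E (QDual E)))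
      (T.toAddMonoidHom.completion hT u) := by
  have h1 := h.map (T.toAddMonoidHom.completion hT) (AddMonoidHom.continuous_completion _ hT)
  have h2 : ∀ i, T.toAddMonoidHom.completion hT (a i • itmul (e i) (f i))
      = a i • ((T (qtmul (e i) (f i)) : QTensor E (QDual E)) : IndTensor E (QDual E)) := by
    intro i
    rw [itmul, ← UniformSpace.Completion.coe_smul]
    refine (AddMonoidHom.completion_coe _ hT _).trans ?_
    rw [LinearMap.toAddMonoidHom_coe, map_smul, UniformSpace.Completion.coe_smul]
  simpa only [Function.comp_def, h2] using h1

/-- Summing over `l` first, the inner sum is the extension of `composeRight (x k) (x' k)` applied to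
`v`. So `w` depends on `v` only as an element, not on its representation. -/
theorem IsComposition.hasSum_right {μ ν : ℕ → ℝ} {x y : ℕ → E} {x' y' : ℕ → QDual E}
    {v w : IndTensor E (QDual E)} (hv : HasSum (fun l => ν l • itmul (y l) (y' l)) v)
    (hw : HasSum (fun kl : ℕ × ℕ =>
      (μ kl.1 * ν kl.2) • itmul (y kl.2 <• (y' kl.2 (x kl.1))) (x' kl.1)) w) :
    HasSum (fun k => μ k • (composeRight (x k) (x' k)).toAddMonoidHom.completion
      (continuous_composeRight _ _) v) w := by
  refine hw.prod_fiberwise fun k => ?_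
  have h := (hasSum_completion_map _ (continuous_composeRight (x k) (x' k)) hv).const_smul (μ k)
  simpa only [composeRight_qtmul, smul_smul, itmul] using h

/-- The mirror statement: summing over `k` first shows that the representation of `u` is irrelevant.
-/
theorem IsComposition.hasSum_left {μ ν : ℕ → ℝ} {x y : ℕ → E} {x' y' : ℕ → QDual E}
    {u w : IndTensor E (QDual E)} (hu : HasSum (fun k => μ k • itmul (x k) (x' k)) u)
    (hw : HasSum (fun kl : ℕ × ℕ =>
      (μ kl.1 * ν kl.2) • itmul (y kl.2 <• (y' kl.2 (x kl.1))) (x' kl.1)) w) :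
    HasSum (fun l => ν l • (composeLeft (y l) (y' l)).toAddMonoidHom.completion
      (continuous_composeLeft _ _) u) w := by
  refine ((Equiv.prodComm ℕ ℕ).hasSum_iff.2 hw).prod_fiberwise fun l => ?_
  have h := (hasSum_completion_map _ (continuous_composeLeft (y l) (y' l)) hu).const_smul (ν l)
  simpa only [composeLeft_qtmul, smul_smul, mul_comm (ν l), itmul, Function.comp_def,
    Equiv.prodComm_apply, Prod.fst_swap, Prod.snd_swap, Prod.swap_prod_mk] using h

/-- The double series defining the composition converges. -/
theorem summable_composition {μ ν : ℕ → ℝ} {x y : ℕ → E} {x' y' : ℕ → QDual E}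
    (hv : IsFredholmData ν y y') (hu : IsFredholmData μ x x') :
    Summable fun kl : ℕ × ℕ =>
      (μ kl.1 * ν kl.2) • itmul (y kl.2 <• (y' kl.2 (x kl.1))) (x' kl.1) := by
  obtain ⟨Bx, hBx, hx⟩ := hu.disk
  obtain ⟨Bx', hBx', hx'⟩ := hu.disk'
  obtain ⟨By, hBy, hy⟩ := hv.disk
  obtain ⟨By', hBy', hy'⟩ := hv.disk'
  obtain ⟨C, hC0, hC⟩ := QDual.exists_forall_norm_apply_le hBx.bounded hBy'.bounded
  have hsum : Summable fun kl : ℕ × ℕ => |C * (μ kl.1 * ν kl.2)| := by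
    simp only [abs_mul]
    exact (hu.summable.mul_of_nonneg hv.summable (fun _ => abs_nonneg _)
      fun _ => abs_nonneg _).mul_left _
  -- Dividing the scalars `⟨y'_l, x_k⟩` by their bound `C` keeps the vectors in the balanced disk of
  -- the `y_l`; the factor `C` goes into the coefficients.
  have h := summable_smul_itmul hsum hBy hBx'.bounded
    (e := fun kl => y kl.2 <• (C⁻¹ • y' kl.2 (x kl.1))) (f := fun kl => x' kl.1)
    (fun kl => mem_of_balanced hBy.balanced (hy _) (by
      rw [norm_smul, norm_inv, Real.norm_of_nonneg hC0.le, inv_mul_le_one₀ hC0]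
      exact hC _ (hy' _) _ (hx _)))
    (fun kl => hx' _)
  convert h using 2 with kl
  have h1 : ∀ (c : ℝ) (z : E) (f : QDual E), itmul (c • z) f = c • itmul z f := fun c z f => by
    rw [itmul, qtmul_smul_left, UniformSpace.Completion.coe_smul]; rfl
  rw [op_real_smul, h1, smul_smul, mul_right_comm, mul_inv_cancel₀ hC0.ne', one_mul]

/-- The composition of Fredholm kernels does not depend on the representations. -/
theorem IsComposition.unique {v u w₁ w₂ : IndTensor E (QDual E)} (h₁ : IsComposition v u w₁)
    (h₂ : IsComposition v u w₂) : w₁ = w₂ := by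
  obtain ⟨ν₁, y₁, y₁', μ₁, x₁, x₁', hv₁, hu₁, hw₁⟩ := h₁
  obtain ⟨ν₂, y₂, y₂', μ₂, x₂, x₂', hv₂, hu₂, hw₂⟩ := h₂
  -- The mixed sum, with the second representation of `v` and the first of `u`, is compared with
  -- `w₁` and with `w₂`, changing one representation at a time.
  obtain ⟨w, hw⟩ := summable_composition hv₂.1 hu₁.1
  rw [(hasSum_right hv₁.2 hw₁).unique (hasSum_right hv₂.2 hw)]
  exact (hasSum_left hu₁.2 hw).unique (hasSum_left hu₂.2 hw₂)

theorem comp_eq_of_isComposition {v u w : IndTensor E (QDual E)} (h : IsComposition v u w) :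
    comp v u = w := by
  have h' : ∃ w, IsComposition v u w := ⟨w, h⟩
  rw [comp, dif_pos h']
  exact h'.choose_spec.unique h

end Composition

/-! ### Powers of a kernel and their traces as sums over paths. -/

section Powers

variable {E : Type*} [AddCommGroup E] [Module ℝ E] [Module ℍ[ℝ]ᵐᵒᵖ E]
  [IsScalarTower ℝ ℍ[ℝ]ᵐᵒᵖ E] [TopologicalSpace E]

/-- The coefficients of the iterated series for `u ^ (n + 1)`; the index `j` codes a path of
length `n + 1` through the unpairing function. -/
def pathCoeff (μ : ℕ → ℝ) : ℕ → ℕ → ℝ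
  | 0, j => μ j
  | n + 1, j => pathCoeff μ n j.unpair.1 * μ j.unpair.2

/-- The starting point of the path coded by `j`. -/
def pathStart : ℕ → ℕ → ℕ
  | 0, j => j
  | n + 1, j => pathStart n j.unpair.1

/-- The vectors of the iterated series for `u ^ (n + 1)`. -/
def pathVec (x : ℕ → E) (x' : ℕ → QDual E) : ℕ → ℕ → E
  | 0, j => x j
  | n + 1, j => x j.unpair.2 <• (x' j.unpair.2 (pathVec x x' n j.unpair.1))

theorem summable_abs_pathCoeff {μ : ℕ → ℝ} (hμ : Summable fun k => |μ k|) (n : ℕ) :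
    Summable fun j => |pathCoeff μ n j| := by
  induction n with
  | zero => exact hμ
  | succ n ih =>
    have h := ih.mul_of_nonneg hμ (fun _ => abs_nonneg _) fun _ => abs_nonneg _
    have h2 := Nat.pairEquiv.symm.summable_iff.2 h
    simp only [pathCoeff, abs_mul]
    exact h2

theorem pathVec_mem {B : Set E} (hB : Balanced ℍ[ℝ]ᵐᵒᵖ B) {x : ℕ → E} {x' : ℕ → QDual E}
    (hx : ∀ k, x k ∈ B) (hbound : ∀ k, ∀ y ∈ B, ‖x' k y‖ ≤ 1) (n j : ℕ) :
    pathVec x x' n j ∈ B := by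
  induction n generalizing j with
  | zero => exact hx j
  | succ n ih => exact mem_of_balanced hB (hx _) (hbound _ _ (ih _))

variable [ContinuousSMul ℍ[ℝ]ᵐᵒᵖ E]

/-- Under `hbound` the iterated vectors stay in the same disk `B`, so every power has admissible
data and can be composed with `u` again; the pairing bijection turns the double series into a single
one. -/
theorem isFredholmRep_kernelPow {μ : ℕ → ℝ} {x : ℕ → E} {x' : ℕ → QDual E}
    {u : IndTensor E (QDual E)} (hμ : Summable fun k => |μ k|)
    (hu : HasSum (fun k => μ k • itmul (x k) (x' k)) u)
    {B : Set E} (hB : IsBanachDisk ℍ[ℝ]ᵐᵒᵖ B) (hx : ∀ k, x k ∈ B)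
    {B' : Set (QDual E)} (hB' : IsBanachDisk ℍ[ℝ] B') (hx' : ∀ k, x' k ∈ B')
    (hbound : ∀ k, ∀ y ∈ B, ‖x' k y‖ ≤ 1) (n : ℕ) :
    IsFredholmRep (pathCoeff μ n) (pathVec x x' n) (fun j => x' (pathStart n j))
      (kernelPow u n) := by
  have hdata : ∀ n, IsFredholmData (pathCoeff μ n) (pathVec x x' n) (fun j => x' (pathStart n j)) :=
    fun n => ⟨summable_abs_pathCoeff hμ n, ⟨B, hB, pathVec_mem hB.balanced hx hbound n⟩,
      ⟨B', hB', fun _ => hx' _⟩⟩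
  refine ⟨hdata n, ?_⟩
  induction n with
  | zero => exact hu
  | succ n ih =>
    have h0 : IsFredholmData μ x x' := hdata 0
    obtain ⟨w, hw⟩ := summable_composition h0 (hdata n)
    have hcomp : IsComposition u (kernelPow u n) w :=
      ⟨μ, x, x', pathCoeff μ n, pathVec x x' n, fun j => x' (pathStart n j), ⟨h0, hu⟩,
        ⟨hdata n, ih⟩, hw⟩
    rw [kernelPow, comp_eq_of_isComposition hcomp]
    have h := Nat.pairEquiv.symm.hasSum_iff.2 hw
    exact h

/-- The extended trace is a continuous additive map, hence acts termwise on convergent sums. -/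
theorem hasSum_qTrace {ι : Type*} {a : ι → ℝ} {e : ι → E} {f : ι → QDual E}
    {u : IndTensor E (QDual E)} (h : HasSum (fun i => a i • itmul (e i) (f i)) u) :
    HasSum (fun i => a i * (2 * (f i (e i)).re)) (qTrace u) := by
  have := continuousSMul_real (E := E)
  have h1 := h.map (AddMonoidHom.extension (traceAlg (E := E)).toAddMonoidHom continuous_traceAlg)
    (AddMonoidHom.continuous_extension _ _)
  have h2 : ∀ i, a i * (2 * (f i (e i)).re) = qTrace (a i • itmul (e i) (f i)) := by
    intro i
    rw [itmul, ← UniformSpace.Completion.coe_smul, qTrace_coe, map_smul, traceAlg,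
      QTensor.lift_qtmul, pairing_apply, smul_eq_mul]
  simp only [h2]
  exact h1

end Powers

end QuatLCS

end

noncomputable section

namespace QuatLCS

/-! ### Quaternions as complex matrices. -/

section ComplexRepresentation

/-- The representation of quaternions by complex `2 × 2` matrices. -/
def quatMatrix : ℍ[ℝ] →ₗ[ℝ] Matrix (Fin 2) (Fin 2) ℂ where
  toFun q := !![⟨q.re, q.imI⟩, ⟨q.imJ, q.imK⟩; ⟨-q.imJ, q.imK⟩, ⟨q.re, -q.imI⟩]
  map_add' p q := by
    ext i j
    fin_cases i <;> fin_cases j <;> apply Complex.ext <;> simp <;> ring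
  map_smul' c q := by
    ext i j
    fin_cases i <;> fin_cases j <;> apply Complex.ext <;> simp

theorem quatMatrix_apply (q : ℍ[ℝ]) :
    quatMatrix q = !![⟨q.re, q.imI⟩, ⟨q.imJ, q.imK⟩; ⟨-q.imJ, q.imK⟩, ⟨q.re, -q.imI⟩] := rfl

theorem quatMatrix_mul (p q : ℍ[ℝ]) : quatMatrix (p * q) = quatMatrix p * quatMatrix q := by
  simp only [quatMatrix_apply]
  ext i j
  fin_cases i <;> fin_cases j <;> apply Complex.ext <;>
    simp [Matrix.mul_apply, Fin.sum_univ_two] <;> ring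

/-- This explains the factor `2` in the quaternionic trace: `2 Re q` is the complex trace of the
matrix of `q`. -/
theorem sum_quatMatrix_diag (q : ℍ[ℝ]) : ∑ a, quatMatrix q a a = ((2 * q.re : ℝ) : ℂ) := by
  apply Complex.ext <;> simp [quatMatrix_apply, Fin.sum_univ_two]; ring

theorem abs_re_le_norm (q : ℍ[ℝ]) : |q.re| ≤ ‖q‖ := by
  refine abs_le_of_sq_le_sq ?_ (norm_nonneg _)
  rw [sq ‖q‖, ← Quaternion.normSq_eq_norm_mul_self, Quaternion.normSq_def']
  nlinarith [sq_nonneg q.imI, sq_nonneg q.imJ, sq_nonneg q.imK]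

theorem norm_quatMatrix_le (q : ℍ[ℝ]) (a b : Fin 2) : ‖quatMatrix q a b‖ ≤ ‖q‖ := by
  have h : ‖q‖ * ‖q‖ = q.re ^ 2 + q.imI ^ 2 + q.imJ ^ 2 + q.imK ^ 2 := by
    rw [← Quaternion.normSq_eq_norm_mul_self, Quaternion.normSq_def']
  refine le_of_sq_le_sq ?_ (norm_nonneg _)
  rw [← Complex.normSq_eq_norm_sq, sq ‖q‖, h, Complex.normSq_apply]
  fin_cases a <;> fin_cases b <;> simp [quatMatrix_apply] <;>
    nlinarith [sq_nonneg q.re, sq_nonneg q.imI, sq_nonneg q.imJ, sq_nonneg q.imK]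

end ComplexRepresentation

/-! ### Path sums as traces of matrix powers, truncation, and the uniform coefficient bound. -/

section PathSums

open Filter Topology Finset

/-- The product of matrix entries along the path coded by `j`, with end point `m`. -/
def pathProd (G : ℕ → ℕ → ℍ[ℝ]) : ℕ → ℕ → ℕ → ℍ[ℝ]
  | 0, j, m => G m j
  | n + 1, j, m => G m j.unpair.2 * pathProd G n j.unpair.1 j.unpair.2

/-- The trace of the `(n + 1)`-st power of the infinite matrix `(G m k μ_k)`. -/
def pathTrace (μ : ℕ → ℝ) (G : ℕ → ℕ → ℍ[ℝ]) (n : ℕ) : ℝ :=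
  ∑' j, pathCoeff μ n j * (2 * (pathProd G n j (pathStart n j)).re)

variable {μ : ℕ → ℝ} {G : ℕ → ℕ → ℍ[ℝ]}

theorem norm_pathProd_le (hG : ∀ m k, ‖G m k‖ ≤ 1) (n j m : ℕ) : ‖pathProd G n j m‖ ≤ 1 := by
  induction n generalizing j m with
  | zero => exact hG _ _
  | succ n ih =>
    rw [pathProd, norm_mul]
    exact mul_le_one₀ (hG _ _) (norm_nonneg _) (ih _ _)

theorem abs_two_mul_re_pathProd_le (hG : ∀ m k, ‖G m k‖ ≤ 1) (n j m : ℕ) :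
    |2 * (pathProd G n j m).re| ≤ 2 := by
  have h1 := (abs_re_le_norm (pathProd G n j m)).trans (norm_pathProd_le hG n j m)
  rw [abs_mul, abs_two]
  linarith

/-- Entries of powers of the matrix `(G m k μ_k)` as path sums. -/
def pathEntry (μ : ℕ → ℝ) (G : ℕ → ℕ → ℍ[ℝ]) (n m k : ℕ) : ℍ[ℝ] :=
  ∑' j, if pathStart n j = k then pathCoeff μ n j • pathProd G n j m else 0

theorem summable_pathEntry (hμ : Summable fun k => |μ k|) (hG : ∀ m k, ‖G m k‖ ≤ 1) (n m k : ℕ) :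
    Summable fun j => if pathStart n j = k then pathCoeff μ n j • pathProd G n j m else 0 := by
  refine Summable.of_norm_bounded (summable_abs_pathCoeff hμ n) fun j => ?_
  split_ifs
  · rw [norm_smul, Real.norm_eq_abs]
    exact mul_le_of_le_one_right (abs_nonneg _) (norm_pathProd_le hG n j m)
  · simp

theorem pathEntry_zero (m k : ℕ) : pathEntry μ G 0 m k = μ k • G m k := by
  simp only [pathEntry, pathStart, pathCoeff, pathProd]
  exact tsum_ite_eq k fun j => μ j • G m j

/-- Matrix multiplication: the last index `l` of a path is split off and summed last. -/
theorem pathEntry_succ (hμ : Summable fun k => |μ k|) (hG : ∀ m k, ‖G m k‖ ≤ 1) (n m k : ℕ) :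
    pathEntry μ G (n + 1) m k = ∑' l, μ l • (G m l * pathEntry μ G n l k) := by
  set F : ℕ × ℕ → ℍ[ℝ] := fun jl =>
    if pathStart n jl.1 = k then (pathCoeff μ n jl.1 * μ jl.2) • (G m jl.2 * pathProd G n jl.1 jl.2)
    else 0 with hF
  have hFs : Summable F := (Nat.pairEquiv.symm.summable_iff (f := F)).1
    (summable_pathEntry hμ hG (n + 1) m k)
  have h1 : pathEntry μ G (n + 1) m k = ∑' jl, F jl := Nat.pairEquiv.symm.tsum_eq F
  rw [h1, ← (Equiv.prodComm ℕ ℕ).tsum_eq F]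
  refine (Summable.tsum_prod ((Equiv.prodComm ℕ ℕ).summable_iff.2 hFs)).trans ?_
  refine tsum_congr fun l => ?_
  rw [pathEntry, ← tsum_mul_left, ← tsum_const_smul'']
  refine tsum_congr fun j => ?_
  change (if pathStart n j = k then (pathCoeff μ n j * μ l) • (G m l * pathProd G n j l) else 0) = _
  by_cases h : pathStart n j = k
  · rw [if_pos h, if_pos h, mul_smul_comm, smul_smul, mul_comm (μ l)]
  · rw [if_neg h, if_neg h, mul_zero, smul_zero]

/-- The coefficient of a path contains the factor `μ` at its starting point. -/
theorem pathCoeff_eq_zero {n j : ℕ} (h : μ (pathStart n j) = 0) : pathCoeff μ n j = 0 := by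
  induction n generalizing j with
  | zero => exact h
  | succ n ih => rw [pathCoeff, ih h, zero_mul]

/-- The complex matrix of order `2 N` representing the quaternionic matrix `(G m k μ_k)`. -/
def complexMatrix (μ : ℕ → ℝ) (G : ℕ → ℕ → ℍ[ℝ]) (N : ℕ) :
    Matrix (Fin N × Fin 2) (Fin N × Fin 2) ℂ :=
  Matrix.of fun i k => quatMatrix (μ k.1 • G i.1 k.1) i.2 k.2

/-- Column `l` of the infinite matrix carries the factor `μ l`, so for `μ` supported below `N` the
infinite matrix products reduce to finite ones. -/
theorem complexMatrix_pow (hμ : Summable fun k => |μ k|) (hG : ∀ m k, ‖G m k‖ ≤ 1) {N : ℕ}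
    (hN : ∀ k, N ≤ k → μ k = 0) (n : ℕ) (i k : Fin N × Fin 2) :
    (complexMatrix μ G N ^ (n + 1)) i k = quatMatrix (pathEntry μ G n i.1 k.1) i.2 k.2 := by
  induction n generalizing i with
  | zero => rw [zero_add, pow_one, pathEntry_zero]; rfl
  | succ n ih =>
    have hsum : pathEntry μ G (n + 1) i.1 k.1
        = ∑ l : Fin N, (μ l • G i.1 l) * pathEntry μ G n l k.1 := by
      rw [pathEntry_succ hμ hG, tsum_eq_sum (s := range N), ← Fin.sum_univ_eq_sum_range
        (fun l => μ l • (G i.1 l * pathEntry μ G n l k.1)) N]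
      · simp only [smul_mul_assoc]
      · intro l hl
        rw [hN l (by simpa using hl), zero_smul]
    rw [pow_succ', Matrix.mul_apply, hsum, map_sum, Matrix.sum_apply, Fintype.sum_prod_type]
    refine Finset.sum_congr rfl fun l _ => ?_
    rw [quatMatrix_mul, Matrix.mul_apply]
    exact Finset.sum_congr rfl fun b _ => by rw [ih]; rfl

theorem trace_complexMatrix_pow (hμ : Summable fun k => |μ k|) (hG : ∀ m k, ‖G m k‖ ≤ 1) {N : ℕ}
    (hN : ∀ k, N ≤ k → μ k = 0) (n : ℕ) :
    (complexMatrix μ G N ^ (n + 1)).trace = (pathTrace μ G n : ℂ) := by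
  -- The paths in the trace are closed, so they are sorted by their common start and end point `k`;
  -- those starting at or beyond `N` contribute nothing.
  have h1 : pathTrace μ G n = ∑ k ∈ range N, 2 * (pathEntry μ G n k k).re := by
    have h2 : ∀ j, pathCoeff μ n j * (2 * (pathProd G n j (pathStart n j)).re)
        = ∑ k ∈ range N, 2 * (if pathStart n j = k then pathCoeff μ n j • pathProd G n j k
          else 0 : ℍ[ℝ]).re := by
      intro j
      by_cases hj : pathStart n j < N
      · rw [Finset.sum_eq_single (pathStart n j)]
        · rw [if_pos rfl, Quaternion.re_smul, smul_eq_mul]; ring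
        · intro k _ hk
          rw [if_neg hk.symm]; simp
        · intro h
          exact absurd (mem_range.2 hj) h
      · rw [pathCoeff_eq_zero (hN _ (not_lt.1 hj))]; simp
    have hre : ∀ k, HasSum (fun j => 2 * (if pathStart n j = k then
        pathCoeff μ n j • pathProd G n j k else 0 : ℍ[ℝ]).re) (2 * (pathEntry μ G n k k).re) :=
      fun k => by
        have := ((summable_pathEntry hμ hG n k k).hasSum.map
          (QuaternionAlgebra.reₗ (-1 : ℝ) (0 : ℝ) (-1 : ℝ)) Quaternion.continuous_re).mul_left 2
        exact this
    rw [pathTrace]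
    simp only [h2]
    exact (hasSum_sum fun k _ => hre k).tsum_eq
  rw [h1, Matrix.trace, Fintype.sum_prod_type]
  simp only [Matrix.diag_apply, complexMatrix_pow hμ hG hN]
  simp only [sum_quatMatrix_diag]
  rw [Complex.ofReal_sum, ← Fin.sum_univ_eq_sum_range
    (fun k => ((2 * (pathEntry μ G n k k).re : ℝ) : ℂ)) N]

/-- The truncation of a sequence to its first `N` terms. -/
def truncate (μ : ℕ → ℝ) (N k : ℕ) : ℝ := if k < N then μ k else 0

theorem abs_truncate_le (μ : ℕ → ℝ) (N k : ℕ) : |truncate μ N k| ≤ |μ k| := by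
  rw [truncate]; split_ifs <;> simp

theorem abs_pathCoeff_truncate_le (μ : ℕ → ℝ) (N n j : ℕ) :
    |pathCoeff (truncate μ N) n j| ≤ |pathCoeff μ n j| := by
  induction n generalizing j with
  | zero => exact abs_truncate_le μ N j
  | succ n ih =>
    rw [pathCoeff, pathCoeff, abs_mul, abs_mul]
    exact mul_le_mul (ih _) (abs_truncate_le _ _ _) (abs_nonneg _) (abs_nonneg _)

theorem tendsto_truncate (μ : ℕ → ℝ) (k : ℕ) :
    Tendsto (fun N => truncate μ N k) atTop (𝓝 (μ k)) := by
  refine tendsto_const_nhds.congr' ?_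
  filter_upwards [eventually_gt_atTop k] with N hN
  rw [truncate, if_pos hN]

theorem tendsto_pathCoeff_truncate (μ : ℕ → ℝ) (n j : ℕ) :
    Tendsto (fun N => pathCoeff (truncate μ N) n j) atTop (𝓝 (pathCoeff μ n j)) := by
  induction n generalizing j with
  | zero => exact tendsto_truncate μ j
  | succ n ih => exact (ih _).mul (tendsto_truncate μ _)

theorem tendsto_pathTrace_truncate (hμ : Summable fun k => |μ k|) (hG : ∀ m k, ‖G m k‖ ≤ 1)
    (n : ℕ) : Tendsto (fun N => pathTrace (truncate μ N) G n) atTop (𝓝 (pathTrace μ G n)) := by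
  refine tendsto_tsum_of_dominated_convergence ((summable_abs_pathCoeff hμ n).mul_right 2)
    (fun j => (tendsto_pathCoeff_truncate μ n j).mul_const _) (Eventually.of_forall fun N j => ?_)
  rw [norm_mul, Real.norm_eq_abs, Real.norm_eq_abs]
  exact mul_le_mul (abs_pathCoeff_truncate_le μ N n j) (abs_two_mul_re_pathProd_le hG _ _ _)
    (abs_nonneg _) (abs_nonneg _)

/-- The `k`-th determinantal trace of a sequence of power traces. -/
def newtonTrace (t : ℕ → ℝ) (k : ℕ) : ℝ :=
  (1 / (k.factorial : ℝ)) * Matrix.det (Matrix.of fun i j : Fin k =>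
    if (j : ℕ) ≤ i then t (i - j)
    else if (j : ℕ) = i + 1 then (k : ℝ) - 1 - (i : ℝ) else 0)

theorem continuous_newtonTrace (k : ℕ) : Continuous fun t : ℕ → ℝ => newtonTrace t k := by
  refine continuous_const.mul (Continuous.matrix_det (continuous_matrix fun i j => ?_))
  simp only [Matrix.of_apply]
  split_ifs <;> fun_prop

open Polynomial in
-- The coefficients of `det (1 + X M)` satisfy Newton's recurrence with the power traces of `M`, and
-- the Hessenberg determinant solves that recurrence.
theorem newtonTrace_eq_coeff {n : Type*} [Fintype n] [DecidableEq n] (M : Matrix n n ℂ) {t : ℕ → ℝ}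
    (ht : ∀ j, (M ^ (j + 1)).trace = (t j : ℂ)) (k : ℕ) :
    (newtonTrace t k : ℂ) = (Matrix.det (1 + (X : ℂ[X]) • M.map C)).coeff k := by
  have h0 : (Matrix.det (1 + (X : ℂ[X]) • M.map C)).coeff 0 = 1 := by
    rw [coeff_zero_eq_eval_zero, eval_det_add_X_smul, Matrix.det_one, eval_one]
  have h := Matrix.det_newton_hessenberg (fun j => (t j : ℂ))
    (fun j => (Matrix.det (1 + (X : ℂ[X]) • M.map C)).coeff j) h0
    (fun j => by simpa only [ht] using Matrix.succ_mul_coeff_det_one_add_X_smul M j) k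
  have hk : (k.factorial : ℂ) ≠ 0 := by exact_mod_cast k.factorial_ne_zero
  rw [newtonTrace, Complex.ofReal_mul, ← Complex.ofRealHom_eq_coe (Matrix.det _), RingHom.map_det]
  push_cast
  rw [one_div, inv_mul_eq_iff_eq_mul₀ hk, ← h]
  congr 1
  ext i j
  simp only [RingHom.mapMatrix_apply, Matrix.map_apply, Matrix.of_apply, Complex.ofRealHom_eq_coe]
  split_ifs <;> simp

theorem abs_newtonTrace_truncate_le (hμ : Summable fun k => |μ k|) (hG : ∀ m k, ‖G m k‖ ≤ 1)
    {p : ℝ} (hp₀ : 0 < p) (hp₁ : p ≤ 1) (hμp : Summable fun k => |μ k| ^ p) (N k : ℕ) :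
    |newtonTrace (pathTrace (truncate μ N) G) k|
      ≤ Real.exp (2 * (∑' k, |μ k| ^ p) / p) ^ k / (k.factorial : ℝ) ^ (1 / p - 1 / 2) := by
  have hμN : Summable fun k => |truncate μ N k| :=
    hμ.of_nonneg_of_le (fun _ => abs_nonneg _) (abs_truncate_le μ N)
  have h1 := newtonTrace_eq_coeff (complexMatrix (truncate μ N) G N)
    (trace_complexMatrix_pow hμN hG fun k hk => if_neg (not_lt.2 hk)) k
  have h2 := Matrix.norm_coeff_det_one_add_X_smul_le (complexMatrix (truncate μ N) G N)
    (fun i => |truncate μ N i.1|) (fun _ => abs_nonneg _)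
    (fun i l => (norm_quatMatrix_le _ _ _).trans (by
      rw [norm_smul, Real.norm_eq_abs]
      exact mul_le_of_le_one_right (abs_nonneg _) (hG _ _))) hp₀ hp₁ k
  rw [← h1, Complex.norm_real, Real.norm_eq_abs] at h2
  refine h2.trans ?_
  -- Each weight occurs for two complex columns, whence the factor `2`.
  have h3 : ∑ j : Fin N × Fin 2, |truncate μ N j.1| ^ p ≤ 2 * ∑' k, |μ k| ^ p := by
    rw [Fintype.sum_prod_type]
    simp only [Finset.sum_const, Finset.card_univ, Fintype.card_fin, nsmul_eq_mul]
    rw [← Finset.mul_sum, Fin.sum_univ_eq_sum_range (fun k => |truncate μ N k| ^ p) N]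
    push_cast
    refine mul_le_mul_of_nonneg_left ?_ zero_le_two
    refine le_trans (Finset.sum_le_sum fun k _ => ?_)
      (hμp.sum_le_tsum (range N) fun k _ => Real.rpow_nonneg (abs_nonneg _) _)
    exact Real.rpow_le_rpow (abs_nonneg _) (abs_truncate_le μ N k) hp₀.le
  gcongr

/-- The bound for truncations is independent of `N`, and a determinantal trace is a continuous
function of the power traces, which converge. -/
theorem abs_newtonTrace_pathTrace_le (hμ : Summable fun k => |μ k|) (hG : ∀ m k, ‖G m k‖ ≤ 1)
    {p : ℝ} (hp₀ : 0 < p) (hp₁ : p ≤ 1) (hμp : Summable fun k => |μ k| ^ p) (k : ℕ) :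
    |newtonTrace (pathTrace μ G) k|
      ≤ Real.exp (2 * (∑' k, |μ k| ^ p) / p) ^ k / (k.factorial : ℝ) ^ (1 / p - 1 / 2) :=
  le_of_tendsto
    (((continuous_newtonTrace k).tendsto _).comp
      (tendsto_pi_nhds.2 (tendsto_pathTrace_truncate hμ hG))).abs
    (Eventually.of_forall fun N => abs_newtonTrace_truncate_le hμ hG hp₀ hp₁ hμp N k)

end PathSums

/-! ### From kernels to the matrix estimate. -/

section Kernels

variable {E : Type*} [AddCommGroup E] [Module ℝ E] [Module ℍ[ℝ]ᵐᵒᵖ E]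
  [IsScalarTower ℝ ℍ[ℝ]ᵐᵒᵖ E] [TopologicalSpace E]

theorem apply_pathVec (x : ℕ → E) (x' : ℕ → QDual E) (n j m : ℕ) :
    x' m (pathVec x x' n j) = pathProd (fun m k => x' m (x k)) n j m := by
  induction n generalizing j m with
  | zero => rfl
  | succ n ih => rw [pathVec, QDual.map_smul_right, ih]; rfl

/-- A Fredholm kernel has a representation whose functionals are bounded by `1` on the disk
containing its vectors. -/
theorem IsPSummableFredholmKernel.exists_normalized {p : ℝ} {u : IndTensor E (QDual E)}
    (hu : IsPSummableFredholmKernel p u) :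
    ∃ (μ : ℕ → ℝ) (x : ℕ → E) (x' : ℕ → QDual E) (B : Set E) (B' : Set (QDual E)),
      (Summable fun k => |μ k|) ∧ (Summable fun k => |μ k| ^ p) ∧
      HasSum (fun k => μ k • itmul (x k) (x' k)) u ∧ IsBanachDisk ℍ[ℝ]ᵐᵒᵖ B ∧ (∀ k, x k ∈ B) ∧
      IsBanachDisk ℍ[ℝ] B' ∧ (∀ k, x' k ∈ B') ∧ ∀ k, ∀ y ∈ B, ‖x' k y‖ ≤ 1 := by
  obtain ⟨μ, x, x', ⟨⟨hμ, ⟨B, hB, hx⟩, ⟨B', hB', hx'⟩⟩, hsum⟩, hp⟩ := hu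
  obtain ⟨C, -, hC⟩ := QDual.exists_forall_norm_apply_le hB.bounded hB'.bounded
  -- `D ≥ C` normalizes the functionals on `B`, and `D ≥ 1` keeps `D⁻¹ • x' k` in the balanced set
  -- `B'`.
  set D : ℝ := max C 1 with hD
  have hD0 : 0 < D := lt_of_lt_of_le one_pos (le_max_right _ _)
  refine ⟨fun k => D * μ k, x, fun k => D⁻¹ • x' k, B, B', ?_, ?_, ?_, hB, hx, hB', fun k => ?_,
    fun k y hy => ?_⟩
  · simp only [abs_mul]; exact hμ.mul_left _
  · simp only [abs_mul, Real.mul_rpow (abs_nonneg _) (abs_nonneg _)]; exact hp.mul_left _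
  · convert hsum using 2 with k
    rw [itmul, qtmul_smul_right, UniformSpace.Completion.coe_smul, smul_smul, mul_right_comm,
      mul_inv_cancel₀ hD0.ne', one_mul]
    rfl
  · refine balanced_real_of_balanced hB'.balanced D⁻¹ ?_ (Set.smul_mem_smul_set (hx' k))
    rw [norm_inv, Real.norm_of_nonneg hD0.le]
    exact inv_le_one_of_one_le₀ (le_max_right _ _)
  · change ‖D⁻¹ • x' k y‖ ≤ 1
    rw [norm_smul, norm_inv, Real.norm_of_nonneg hD0.le, inv_mul_le_one₀ hD0]
    exact (hC _ (hx' k) y hy).trans (le_max_left _ _)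

/-- The coefficients of the Fredholm determinant of a `p`-summable kernel. -/
theorem exists_abs_higherTrace_le [ContinuousSMul ℍ[ℝ]ᵐᵒᵖ E] {p : ℝ} (hp₀ : 0 < p) (hp₁ : p ≤ 1)
    {u : IndTensor E (QDual E)} (hu : IsPSummableFredholmKernel p u) :
    ∃ K : ℝ, 0 ≤ K ∧ ∀ k, |higherTrace u k| ≤ K ^ k / (k.factorial : ℝ) ^ (1 / p - 1 / 2) := by
  obtain ⟨μ, x, x', B, B', hμ, hμp, hsum, hB, hx, hB', hx', hbound⟩ := hu.exists_normalized
  -- By right-linearity, pairing an iterated vector with a functional gives a product of the entries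
  -- `⟨x'_m, x_k⟩` along the path.
  have htrace : ∀ n, qTrace (kernelPow u n) = pathTrace μ (fun m k => x' m (x k)) n := by
    intro n
    have h := hasSum_qTrace
      (isFredholmRep_kernelPow hμ hsum hB hx hB' hx' hbound n).2
    simp only [apply_pathVec] at h
    exact h.tsum_eq.symm
  refine ⟨Real.exp (2 * (∑' k, |μ k| ^ p) / p), (Real.exp_pos _).le, fun k => ?_⟩
  have h := abs_newtonTrace_pathTrace_le hμ (fun m k => hbound m _ (hx k)) hp₀ hp₁ hμp k
  rw [← funext htrace] at h
  exact h

end Kernels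

end QuatLCS

end

/-! ### The theorem on the Fredholm determinant. -/

theorem mainTheorem5 {E : Type*} [AddCommGroup E] [Module ℝ E] [Module ℍ[ℝ]ᵐᵒᵖ E]
    [IsScalarTower ℝ ℍ[ℝ]ᵐᵒᵖ E] [TopologicalSpace E] [T2Space E] [IsTopologicalAddGroup E]
    [ContinuousSMul ℍ[ℝ]ᵐᵒᵖ E] [LocallyConvexSpace ℝ E]
    (p : ℝ) (hp₀ : 0 < p) (hp₁ : p ≤ 1) (u : QuatLCS.IndTensor E (QuatLCS.QDual E))
    (hu : QuatLCS.IsPSummableFredholmKernel p u) :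
    (∀ z : ℂ, Summable fun k : ℕ => (QuatLCS.higherTrace u k : ℂ) * z ^ k) ∧
      Differentiable ℂ (QuatLCS.fredholmDet u) ∧
      QuatLCS.growthOrder (QuatLCS.fredholmDet u) ≤ (((1 / p - 1 / 2)⁻¹ : ℝ) : EReal) := by
  obtain ⟨K, hK, hbound⟩ := QuatLCS.exists_abs_higherTrace_le hp₀ hp₁ hu
  have hα : 0 < 1 / p - 1 / 2 := by
    have : 1 ≤ 1 / p := by rw [le_div_iff₀ hp₀]; linarith
    linarith
  have hc : ∀ k, ‖(QuatLCS.higherTrace u k : ℂ)‖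
      ≤ K ^ k / (k.factorial : ℝ) ^ (1 / p - 1 / 2) := fun k => by
    rw [Complex.norm_real, Real.norm_eq_abs]; exact hbound k
  refine ⟨summable_of_norm_coeff_le hα hK hc, differentiable_tsum_of_norm_coeff_le hα hK hc, ?_⟩
  refine QuatLCS.growthOrder_le_of_norm_coeff_le hα hK ?_ hc
  -- The remaining goal is `T_0 = 1`, an empty determinant.
  simp [QuatLCS.higherTrace]
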